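/- **Setting.** Let $R$ be a regular local ring of dimension two with maximal ideal $\mathfrak m_R=(x,y)$, residue field $\mathfrak k=R/\mathfrak m_R$ and quotient field $K$. Let $\nu$ be a rank 1 valuation of $K$ (written additively) which dominates $R$, with valuation ring $V_\nu$, maximal ideal $\mathfrak m_\nu$ and value group $\Gamma_\nu$. Put $S^R(\nu)=\{\nu(f)\mid 0\ne f\in R\}$, $\mathcal P_\phi=\{f\in R\mid \nu(f)\ge\phi\}$, $\mathcal P_\phi^+=\{f\in R\mid\nu(f)>\phi\}$, $\mathrm{gr}_\nu(R)=\bigoplus_{\phi\in\Gamma_\nu}\mathcal P_\phi/\mathcal P_\phi^+$, and for $0\neq f\in R$ let $\mathrm{in}_\nu(f)$ be the class of $f$ in $\mathcal P_{\nu(f)}/\mathcal P^+_{\nu(f)}$. For $f\in V_\nu$ let $[f]$ be its class in $V_\nu/\mathfrak m_\nu$. Fix a set $CS\subset R$ containing $0$ and $1$ which maps bijectively onto $\mathfrak k$. **The algorithm.** Let $\Omega\in\{1,2,\dots\}\cup\{\infty\}$ and let $P_i\in R$ ($0\le i\le \Omega$, $i<\infty$) be a sequence produced by the following algorithm. Start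 with $P_0=x$, $P_1=y$. For $i\ge 1$, when $P_0,\dots,P_i$ are constructed, let $$\overline n_i=[G(\nu(P_0),\dots,\nu(P_i)):G(\nu(P_0),\dots,\nu(P_{i-1}))]\in\mathbb Z_+\cup\{\infty\},$$ where $G(\dots)$ is the subgroup generated by the listed elements. If $\overline n_i=\infty$, set $\alpha_i=1$. If $\overline n_i<\infty$, let $U_i=P_0^{w_0(i)}\cdots P_{i-1}^{w_{i-1}(i)}$ be a monomial with $w_j(i)\in\mathbb N$, $w_j(i)<n_j$ for $1\le j\le i-1$, and $\nu(U_i)=\overline n_i\nu(P_i)$, and set $\alpha_i=[P_i^{\overline n_i}/U_i]$. Let $$d_i=[\mathfrak k(\alpha_1,\dots,\alpha_i):\mathfrak k(\alpha_1,\dots,\alpha_{i-1})]\in\mathbb Z_+\cup\{\infty\},\qquad n_i=\overline n_id_i .$$ If $\overline n_i=\infty$ or $d_i=\infty$, the algorithm stops with $\Omega=i$. Otherwise let $u^{d_i}+b_{i,d_i-1}u^{d_i-1}+\cdots+b_{i,0}$ be the minimal polynomial of $\alpha_i$ over $\mathfrak k(\alpha_1,\dots,\alpha_{i-1})$, and let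 $$P_{i+1}=P_i^{n_i}+\sum_{k=1}^{\lambda_i}c_kP_0^{\sigma_{i,0}(k)}\cdots P_i^{\sigma_{i,i}(k)}$$ where $0\ne c_k\in CS$, $\sigma_{i,s}(k)\in\mathbb N$, $\sigma_{i,s}(k)<n_s$ for $1\le s\le i$, all monomials in the sum have value $n_i\nu(P_i)$, and $$\Big[\sum_{\sigma_{i,i}(k)=t\overline n_i}c_k\,\frac{P_0^{\sigma_{i,0}(k)}\cdots P_{i-1}^{\sigma_{i,i-1}(k)}}{U_i^{\,d_i-t}}\Big]=b_{i,t}\qquad(0\le t<d_i).$$ If the algorithm never stops, $\Omega=\infty$. **Theorem.** Suppose that $\nu(x)=\nu(\mathfrak m_R):=\min\{\nu(f)\mid 0\neq f\in\mathfrak m_R\}$. In what follows $i$ ranges over the integers with $1\le i\le\Omega$. a) The set $\{\mathrm{in}_\nu(x)\}\cup\{\mathrm{in}_\nu(P_i)\mid n_i>1\}$ minimally generates $\mathrm{gr}_\nu(R)$ as a $\mathfrak k$-algebra: it generates, and no proper subset of it does. b) The set $\{\nu(x)\}\cup\{\nu(P_i)\mid\overline n_i>1\}$ minimally generates the semigroup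 $S^R(\nu)$ (as a semigroup with $0$): it generates, and no proper subset of it does. c) $V_\nu/\mathfrak m_\nu=\mathfrak k(\alpha_i\mid d_i>1)$. -/

import Mathlib

open scoped DirectSum

noncomputable section

namespace ValSemigroup

section Basic

variable (R : Type*) {K Γ : Type*} [CommRing R] [IsLocalRing R] [Field K] [Algebra R K]
  [AddCommGroup Γ] [LinearOrder Γ] [IsOrderedAddMonoid Γ]

/-- The (additively written) valuation `ν` of `K` dominates the local ring `R`: the ring `R` is
contained in the valuation ring of `ν` and `m_ν ∩ R = m_R`. -/
class Dominates (ν : AddValuation K (WithTop Γ)) : Prop where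
  nonneg : ∀ f : R, 0 ≤ ν (algebraMap R K f)
  pos_iff : ∀ f : R, 0 < ν (algebraMap R K f) ↔ f ∈ IsLocalRing.maximalIdeal R

/-- The semigroup `S^R(ν) = {ν(f) | f ∈ R, f ≠ 0}`.  Since `ν` takes the value `⊤` only at `0`,
the condition `ν(f) = γ` with `γ ∈ Γ` forces `f ≠ 0`. -/
def valueSemigroup (ν : AddValuation K (WithTop Γ)) : AddSubmonoid Γ where
  carrier := {γ | ∃ f : R, ν (algebraMap R K f) = (γ : WithTop Γ)}
  zero_mem' := ⟨1, by simp⟩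
  add_mem' := by
    rintro a b ⟨f, hf⟩ ⟨g, hg⟩
    exact ⟨f * g, by simp [hf, hg]⟩

/-- The valuation ring `V_ν` of `ν`. -/
abbrev valRing (ν : AddValuation K (WithTop Γ)) : ValuationSubring K :=
  (AddValuation.toValuation ν).valuationSubring

theorem mem_valRing {ν : AddValuation K (WithTop Γ)} {z : K} : z ∈ valRing ν ↔ 0 ≤ ν z :=
  Iff.rfl

/-- The residue field `V_ν / m_ν` of `ν`. -/
abbrev ValResidueField (ν : AddValuation K (WithTop Γ)) : Type _ :=
  IsLocalRing.ResidueField (valRing ν)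

/-- The class `[z]` of `z ∈ V_ν` in `V_ν / m_ν` (and `0` for elements `z` of `K` outside `V_ν`). -/
def valResidue (ν : AddValuation K (WithTop Γ)) (z : K) : ValResidueField ν :=
  open Classical in
  if h : z ∈ valRing ν then IsLocalRing.residue (valRing ν) ⟨z, h⟩ else 0

/-- The inclusion of `R` into `V_ν`, for `ν` dominating `R`. -/
def toValRing (ν : AddValuation K (WithTop Γ)) [Dominates R ν] : R →+* valRing ν :=
  (algebraMap R K).codRestrict (valRing ν).toSubring fun f => Dominates.nonneg (ν := ν) f

instance (ν : AddValuation K (WithTop Γ)) [Dominates R ν] : IsLocalHom (toValRing R ν) := by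
  refine ⟨fun f hf => ?_⟩
  by_contra h
  have hm : f ∈ IsLocalRing.maximalIdeal R := h
  have hpos := (Dominates.pos_iff (ν := ν) f).2 hm
  obtain ⟨g, hg⟩ := isUnit_iff_exists_inv.1 hf
  have h1 : algebraMap R K f * (g : K) = 1 := congrArg Subtype.val hg
  have h2 : ν (algebraMap R K f) + ν (g : K) = 0 := by
    rw [← AddValuation.map_mul, h1, AddValuation.map_one]
  have h3 : 0 ≤ ν (g : K) := g.2
  exact absurd h2 (ne_of_gt (add_pos_of_pos_of_nonneg hpos h3))

/-- The residue field of `ν` is an extension field of `k = R / m_R`. -/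
instance (ν : AddValuation K (WithTop Γ)) [Dominates R ν] :
    Algebra (IsLocalRing.ResidueField R) (ValResidueField ν) :=
  RingHom.toAlgebra (S := ValResidueField ν) (IsLocalRing.ResidueField.map (toValRing R ν))

end Basic

/-! ### The associated graded ring -/

section Graded

variable (R : Type*) {K Γ : Type*} [CommRing R] [IsLocalRing R] [Field K] [Algebra R K]
  [AddCommGroup Γ] [LinearOrder Γ] [IsOrderedAddMonoid Γ]
  (ν : AddValuation K (WithTop Γ)) [Dominates R ν]

/-- The valuation ideal `P_φ(R) = {f ∈ R | ν(f) ≥ φ}`. -/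
def valIdeal (φ : Γ) : Ideal R where
  carrier := {f | (φ : WithTop Γ) ≤ ν (algebraMap R K f)}
  zero_mem' := by simp
  add_mem' := by
    intro a b ha hb
    simpa using AddValuation.map_le_add ν ha hb
  smul_mem' := by
    intro c a ha
    simpa using add_le_add (Dominates.nonneg (ν := ν) c) ha

/-- The valuation ideal `P_φ⁺(R) = {f ∈ R | ν(f) > φ}`. -/
def valIdealGT (φ : Γ) : Ideal R where
  carrier := {f | (φ : WithTop Γ) < ν (algebraMap R K f)}
  zero_mem' := by simp
  add_mem' := by
    intro a b ha hb
    simpa using AddValuation.map_lt_add ν ha hb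
  smul_mem' := by
    intro c a ha
    have h : ν (algebraMap R K a) ≤ ν (algebraMap R K c) + ν (algebraMap R K a) :=
      le_add_of_nonneg_left (Dominates.nonneg (ν := ν) c)
    simpa using lt_of_lt_of_le ha h

/-- The homogeneous component `P_φ(R) / P_φ⁺(R)` of the associated graded ring. -/
abbrev GrPiece (φ : Γ) : Type _ :=
  valIdeal R ν φ ⧸ (valIdealGT R ν φ).submoduleOf (valIdeal R ν φ)

/-- The class of `f ∈ P_φ(R)` in `P_φ(R) / P_φ⁺(R)`. -/
def GrPiece.mk (φ : Γ) (f : valIdeal R ν φ) : GrPiece R ν φ :=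
  Submodule.Quotient.mk f

variable {R ν}

theorem GrPiece.mk_surjective (φ : Γ) (a : GrPiece R ν φ) : ∃ f, GrPiece.mk R ν φ f = a :=
  Submodule.Quotient.mk_surjective _ a

theorem GrPiece.mk_eq_mk {φ : Γ} {f g : valIdeal R ν φ} :
    GrPiece.mk R ν φ f = GrPiece.mk R ν φ g ↔ (f : R) - g ∈ valIdealGT R ν φ := by
  rw [GrPiece.mk, GrPiece.mk, Submodule.Quotient.eq]
  rfl

theorem mul_mem_valIdeal {φ ψ : Γ} {f g : R} (hf : f ∈ valIdeal R ν φ) (hg : g ∈ valIdeal R ν ψ) :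
    f * g ∈ valIdeal R ν (φ + ψ) := by
  change ((φ + ψ : Γ) : WithTop Γ) ≤ ν (algebraMap R K (f * g))
  rw [map_mul, AddValuation.map_mul, WithTop.coe_add]
  exact add_le_add hf hg

theorem mul_mem_valIdealGT_left {φ ψ : Γ} {f g : R} (hf : f ∈ valIdealGT R ν φ)
    (hg : g ∈ valIdeal R ν ψ) : f * g ∈ valIdealGT R ν (φ + ψ) := by
  change ((φ + ψ : Γ) : WithTop Γ) < ν (algebraMap R K (f * g))
  rw [map_mul, AddValuation.map_mul, WithTop.coe_add]
  exact WithTop.add_lt_add_of_lt_of_le WithTop.coe_ne_top hf hg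

theorem mul_mem_valIdealGT_right {φ ψ : Γ} {f g : R} (hf : f ∈ valIdeal R ν φ)
    (hg : g ∈ valIdealGT R ν ψ) : f * g ∈ valIdealGT R ν (φ + ψ) := by
  rw [mul_comm, add_comm]
  exact mul_mem_valIdealGT_left hg hf

/-- The multiplication `P_φ/P_φ⁺ × P_ψ/P_ψ⁺ → P_{φ+ψ}/P_{φ+ψ}⁺` induced by that of `R`. -/
def GrPiece.mul {φ ψ : Γ} (a : GrPiece R ν φ) (b : GrPiece R ν ψ) : GrPiece R ν (φ + ψ) :=
  Quotient.liftOn₂' a b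
    (fun f g => GrPiece.mk R ν (φ + ψ) ⟨f * g, mul_mem_valIdeal f.2 g.2⟩) (by
      intro f g f' g' hf hg
      rw [GrPiece.mk_eq_mk]
      have hf' : (f : R) - f' ∈ valIdealGT R ν φ := GrPiece.mk_eq_mk.1 (Quotient.sound' hf)
      have hg' : (g : R) - g' ∈ valIdealGT R ν ψ := GrPiece.mk_eq_mk.1 (Quotient.sound' hg)
      have e : (f : R) * g - f' * g' = (f - f') * g + f' * (g - g') := by ring
      simp only
      rw [e]
      exact Ideal.add_mem _ (mul_mem_valIdealGT_left hf' g.2) (mul_mem_valIdealGT_right f'.2 hg'))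

theorem GrPiece.mk_mul_mk {φ ψ : Γ} (f : valIdeal R ν φ) (g : valIdeal R ν ψ) :
    (GrPiece.mk R ν φ f).mul (GrPiece.mk R ν ψ g) =
      GrPiece.mk R ν (φ + ψ) ⟨f * g, mul_mem_valIdeal f.2 g.2⟩ :=
  rfl

theorem GrPiece.mk_add_mk {φ : Γ} (f g : valIdeal R ν φ) :
    GrPiece.mk R ν φ f + GrPiece.mk R ν φ g = GrPiece.mk R ν φ (f + g) :=
  rfl

theorem one_mem_valIdeal : (1 : R) ∈ valIdeal R ν 0 := by
  change ((0 : Γ) : WithTop Γ) ≤ ν (algebraMap R K 1)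
  simp

theorem mem_valIdeal_zero (f : R) : f ∈ valIdeal R ν 0 :=
  Dominates.nonneg (ν := ν) f

instance : GradedMonoid.GMul (GrPiece R ν) where
  mul := GrPiece.mul

instance : GradedMonoid.GOne (GrPiece R ν) where
  one := GrPiece.mk R ν 0 ⟨1, one_mem_valIdeal⟩

theorem GrPiece.sigma_ext {φ ψ : Γ} (h : φ = ψ) {f : valIdeal R ν φ} {g : valIdeal R ν ψ}
    (hfg : (f : R) = g) :
    (⟨φ, GrPiece.mk R ν φ f⟩ : GradedMonoid (GrPiece R ν)) = ⟨ψ, GrPiece.mk R ν ψ g⟩ := by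
  subst h
  rw [Subtype.ext hfg]

instance : DirectSum.GCommRing (GrPiece R ν) where
  mul_zero a := by
    obtain ⟨f, rfl⟩ := GrPiece.mk_surjective _ a
    exact congrArg (GrPiece.mk R ν _) (Subtype.ext (mul_zero _))
  zero_mul a := by
    obtain ⟨f, rfl⟩ := GrPiece.mk_surjective _ a
    exact congrArg (GrPiece.mk R ν _) (Subtype.ext (zero_mul _))
  mul_add a b c := by
    obtain ⟨f, rfl⟩ := GrPiece.mk_surjective _ a
    obtain ⟨g, rfl⟩ := GrPiece.mk_surjective _ b
    obtain ⟨h, rfl⟩ := GrPiece.mk_surjective _ c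
    exact congrArg (GrPiece.mk R ν _) (Subtype.ext (mul_add _ _ _))
  add_mul a b c := by
    obtain ⟨f, rfl⟩ := GrPiece.mk_surjective _ a
    obtain ⟨g, rfl⟩ := GrPiece.mk_surjective _ b
    obtain ⟨h, rfl⟩ := GrPiece.mk_surjective _ c
    exact congrArg (GrPiece.mk R ν _) (Subtype.ext (add_mul _ _ _))
  one_mul := by
    rintro ⟨φ, a⟩
    obtain ⟨f, rfl⟩ := GrPiece.mk_surjective _ a
    exact GrPiece.sigma_ext (zero_add _) (one_mul _)
  mul_one := by
    rintro ⟨φ, a⟩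
    obtain ⟨f, rfl⟩ := GrPiece.mk_surjective _ a
    exact GrPiece.sigma_ext (add_zero _) (mul_one _)
  mul_assoc := by
    rintro ⟨φ, a⟩ ⟨ψ, b⟩ ⟨χ, c⟩
    obtain ⟨f, rfl⟩ := GrPiece.mk_surjective _ a
    obtain ⟨g, rfl⟩ := GrPiece.mk_surjective _ b
    obtain ⟨h, rfl⟩ := GrPiece.mk_surjective _ c
    exact GrPiece.sigma_ext (add_assoc _ _ _) (mul_assoc _ _ _)
  mul_comm := by
    rintro ⟨φ, a⟩ ⟨ψ, b⟩
    obtain ⟨f, rfl⟩ := GrPiece.mk_surjective _ a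
    obtain ⟨g, rfl⟩ := GrPiece.mk_surjective _ b
    exact GrPiece.sigma_ext (add_comm _ _) (mul_comm _ _)
  natCast n := GrPiece.mk R ν 0 ⟨n, mem_valIdeal_zero _⟩
  natCast_zero := congrArg (GrPiece.mk R ν _) (Subtype.ext Nat.cast_zero)
  natCast_succ n := congrArg (GrPiece.mk R ν _) (Subtype.ext (Nat.cast_succ n))
  intCast n := GrPiece.mk R ν 0 ⟨n, mem_valIdeal_zero _⟩
  intCast_ofNat n := congrArg (GrPiece.mk R ν _) (Subtype.ext (Int.cast_natCast n))
  intCast_negSucc_ofNat n := congrArg (GrPiece.mk R ν _) (Subtype.ext (by simp))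

variable (R ν)

/-- The associated graded ring `gr_ν(R) = ⨁_φ P_φ(R) / P_φ⁺(R)`.  (Degrees `φ` outside the value
group of `ν` contribute zero components.) -/
abbrev Gr : Type _ := ⨁ φ : Γ, GrPiece R ν φ

instance : CommRing (Gr R ν) := inferInstance

/-- The ring homomorphism from `R` to the degree zero part of `gr_ν(R)`. -/
def toGr : R →+* Gr R ν where
  toFun r := DirectSum.of (GrPiece R ν) 0 (GrPiece.mk R ν 0 ⟨r, mem_valIdeal_zero r⟩)
  map_one' := rfl
  map_mul' r s := by
    rw [DirectSum.of_mul_of]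
    exact DirectSum.of_eq_of_gradedMonoid_eq (GrPiece.sigma_ext (zero_add 0).symm rfl)
  map_zero' := (DirectSum.of (GrPiece R ν) 0).map_zero
  map_add' r s := ((DirectSum.of (GrPiece R ν) 0).map_add _ _).symm ▸ rfl

/-- `gr_ν(R)` is an algebra over the residue field `k = R / m_R`. -/
instance : Algebra (IsLocalRing.ResidueField R) (Gr R ν) :=
  RingHom.toAlgebra (R := IsLocalRing.ResidueField R) (S := Gr R ν)
    (Ideal.Quotient.lift (IsLocalRing.maximalIdeal R) (toGr R ν) (by
      intro r hr
      have h : GrPiece.mk R ν 0 ⟨r, mem_valIdeal_zero r⟩ = GrPiece.mk R ν 0 0 := by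
        rw [GrPiece.mk_eq_mk]
        change ((0 : Γ) : WithTop Γ) < ν (algebraMap R K (r - 0))
        rw [sub_zero]
        exact (Dominates.pos_iff (ν := ν) r).2 hr
      exact (congrArg (DirectSum.of (GrPiece R ν) 0) h).trans (map_zero _)))

/-- The initial form `in_ν(f) = f + P_φ⁺(R)`, `φ = ν(f)`, of a nonzero element `f` of `R`, as a
homogeneous element of degree `ν(f)` of `gr_ν(R)` (and `0` if `ν(f) = ⊤`, that is, if `f = 0`). -/
def initialForm (f : R) : Gr R ν :=
  open Classical in
  if h : ν (algebraMap R K f) = ⊤ then 0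
  else DirectSum.of (GrPiece R ν) ((ν (algebraMap R K f)).untop h)
    (GrPiece.mk R ν _ ⟨f, (WithTop.coe_untop _ h).le⟩)

end Graded

/-! ### The algorithm -/

section Algorithm

variable {R K Γ : Type*} [CommRing R] [IsLocalRing R] [Field K] [Algebra R K]
  [AddCommGroup Γ] [LinearOrder Γ] [IsOrderedAddMonoid Γ]

/-- A coefficient set of `R`: a subset containing `0` and `1` which maps bijectively onto the
residue field. -/
def IsCoefficientSet (CS : Set R) : Prop :=
  Set.BijOn (IsLocalRing.residue R) CS Set.univ ∧ 0 ∈ CS ∧ 1 ∈ CS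

variable (ν : AddValuation K (WithTop Γ))

/-- The group `G(ν(P_0), …, ν(P_i))` generated by the values of `P_0, …, P_i`. -/
def valGroup (P : ℕ → R) (i : ℕ) : AddSubgroup Γ :=
  AddSubgroup.closure {γ | ∃ j ≤ i, ν (algebraMap R K (P j)) = (γ : WithTop Γ)}

/-- The index `n̄_i = [G(ν(P_0), …, ν(P_i)) : G(ν(P_0), …, ν(P_{i-1}))] ∈ ℕ ∪ {∞}`, for `i ≥ 1`. -/
def nbar (P : ℕ → R) (i : ℕ) : ℕ∞ :=
  ENat.card (valGroup ν P i ⧸ (valGroup ν P (i - 1)).addSubgroupOf (valGroup ν P i))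

/-- The monomial `U_i = P_0^{w_0(i)} ⋯ P_{i-1}^{w_{i-1}(i)}`, where `w_j(i)` is written `w i j`. -/
def monU (P : ℕ → R) (w : ℕ → ℕ → ℕ) (i : ℕ) : R :=
  ∏ j ∈ Finset.range i, P j ^ w i j

/-- The residue `α_i = [P_i^{n̄_i} / U_i]`, for `i ≥ 1`; by convention `α_i = 1` if `n̄_i = ∞`. -/
def alpha (P : ℕ → R) (w : ℕ → ℕ → ℕ) (i : ℕ) : ValResidueField ν :=
  open Classical in
  if nbar ν P i = ⊤ then 1
  else valResidue ν (algebraMap R K (P i) ^ (nbar ν P i).toNat / algebraMap R K (monU P w i))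

variable [Dominates R ν]

/-- The subfield `k(α_1, …, α_i)` of `V_ν / m_ν`. -/
def alphaField (P : ℕ → R) (w : ℕ → ℕ → ℕ) (i : ℕ) :
    IntermediateField (IsLocalRing.ResidueField R) (ValResidueField ν) :=
  IntermediateField.adjoin _ {a | ∃ j, 1 ≤ j ∧ j ≤ i ∧ a = alpha ν P w j}

/-- The degree `d_i = [k(α_1, …, α_i) : k(α_1, …, α_{i-1})] ∈ ℕ ∪ {∞}`, for `i ≥ 1`. -/
def deg (P : ℕ → R) (w : ℕ → ℕ → ℕ) (i : ℕ) : ℕ∞ :=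
  Cardinal.toENat
    (IntermediateField.relrank (alphaField ν P w (i - 1)) (alphaField ν P w i))

/-- `n_i = n̄_i d_i`, for `i ≥ 1`. -/
def nn (P : ℕ → R) (w : ℕ → ℕ → ℕ) (i : ℕ) : ℕ∞ :=
  nbar ν P i * deg ν P w i

/-- One step of the algorithm, from `P_0, …, P_i` to `P_{i+1}`, for `i ≥ 1` with `n_i < ∞`:
`P_{i+1} = P_i^{n_i} + ∑_k c_k P_0^{σ_0(k)} ⋯ P_i^{σ_i(k)}` with `0 ≠ c_k ∈ CS`, `σ_s(k) < n_s` for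
`1 ≤ s ≤ i`, with all monomials of the value `n_i ν(P_i)`, and such that for `0 ≤ t < d_i` the
coefficient of `u^t` in the minimal polynomial of `α_i` over `k(α_1, …, α_{i-1})` is the residue of
`∑_{σ_i(k) = t n̄_i} c_k P_0^{σ_0(k)} ⋯ P_{i-1}^{σ_{i-1}(k)} / U_i^{d_i - t}`. -/
def IsStep (CS : Set R) (P : ℕ → R) (w : ℕ → ℕ → ℕ) (i : ℕ) : Prop :=
  ∃ (l : ℕ) (c : Fin l → R) (σ : Fin l → ℕ → ℕ),
    (∀ k, c k ∈ CS ∧ c k ≠ 0) ∧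
    (∀ k s, 1 ≤ s → s ≤ i → (σ k s : ℕ∞) < nn ν P w s) ∧
    (∀ k, ν (algebraMap R K (∏ s ∈ Finset.range (i + 1), P s ^ σ k s)) =
      ν (algebraMap R K (P i ^ (nn ν P w i).toNat))) ∧
    P (i + 1) = P i ^ (nn ν P w i).toNat +
      ∑ k, c k * ∏ s ∈ Finset.range (i + 1), P s ^ σ k s ∧
    ∀ t : ℕ, t < (deg ν P w i).toNat →
      (((minpoly (alphaField ν P w (i - 1)) (alpha ν P w i)).coeff t :
          alphaField ν P w (i - 1)) : ValResidueField ν) =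
        valResidue ν (∑ k with σ k i = t * (nbar ν P i).toNat,
          algebraMap R K (c k * ∏ s ∈ Finset.range i, P s ^ σ k s) /
            algebraMap R K (monU P w i) ^ ((deg ν P w i).toNat - t))

/-- `(P_i)_{0 ≤ i ≤ Ω, i < ∞}`, with the exponents `w` of the monomials `U_i`, is a sequence
produced from `P_0 = x`, `P_1 = y` by the algorithm with respect to the coefficient set `CS`.
The members `P_i` with `i > Ω` play no role. -/
structure IsAlgorithmOutput (CS : Set R) (x y : R) (Ω : ℕ∞) (P : ℕ → R) (w : ℕ → ℕ → ℕ) :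
    Prop where
  one_le : 1 ≤ Ω
  P_zero : P 0 = x
  P_one : P 1 = y
  /-- Whenever `n̄_i < ∞`, the monomial `U_i` satisfies `ν(U_i) = n̄_i ν(P_i)`, and its exponents are
  bounded by `w_j(i) < n_j` for `1 ≤ j < i`. -/
  monU_spec : ∀ i : ℕ, 1 ≤ i → (i : ℕ∞) ≤ Ω → nbar ν P i ≠ ⊤ →
    (∀ j, 1 ≤ j → j < i → (w i j : ℕ∞) < nn ν P w j) ∧
    ν (algebraMap R K (P i ^ (nbar ν P i).toNat)) = ν (algebraMap R K (monU P w i))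
  /-- Before the last index, `n̄_i` and `d_i` are finite and `P_{i+1}` is constructed. -/
  step : ∀ i : ℕ, 1 ≤ i → (i : ℕ∞) < Ω →
    nbar ν P i ≠ ⊤ ∧ deg ν P w i ≠ ⊤ ∧ IsStep ν CS P w i
  /-- The algorithm stops at the index `Ω < ∞` only if `n̄_Ω = ∞` or `d_Ω = ∞`. -/
  terminates : ∀ m : ℕ, Ω = m → nbar ν P m = ⊤ ∨ deg ν P w m = ⊤

end Algorithm

end ValSemigroup

end

/-!
The proof rests on two facts about the sequence `P_0, P_1, …`, where a monomial `P_0^{σ_0} ⋯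
P_r^{σ_r}` is called reduced if `σ_s < n_s` for `1 ≤ s ≤ r`.

*Independence.* The residues of distinct reduced monomials of one value `φ`, divided by a fixed
Laurent monomial of value `φ`, are linearly independent over `k` (`HasValues.coeff_eq_zero`). The
exponents of `P_r` in such monomials are congruent modulo `n̄_r`, so that the residues are
`α_r^q`, with `q < d_r` up to a common shift, times residues of Laurent monomials of value zero in
`P_0, …, P_{r-1}`; the latter lie in `k(α_1, …, α_{r-1})` (`HasValues.valResidue_lmon_mem`), over
which the powers of `α_r` involved are independent. Induction on `r` finishes.

*Spanning.* Each `P_i` is congruent modulo `x` to the power `y^{n_1 ⋯ n_{i-1}}`, because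
`ν(P_{i+1}) > n_i ν(P_i)`, so that a reduced monomial in `P_1, …, P_i` alone has too small a value
to occur in `P_{i+1}` (`IsGenSeq.sub_mem_of_isStep`). The jump of the values holds because the
residue of `P_{i+1} / U_i^{d_i}` is the minimal polynomial of `α_i` evaluated at `α_i`
(`HasValues.value_lt_of_isStep`). By mixed radix expansion of exponents every power of `y` is then
congruent modulo `x` to a monomial in the `P_s`, and every `f ∈ R` is a combination of monomials
with coefficients in `CS` up to elements of large value. When `r` is the last index, or `ν(P_r)`
is large, the monomials that matter are reduced, and by independence nothing cancels: `f` agrees,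
up to larger values, with a combination of reduced monomials of the value `ν(f)`
(`IsGenSeq.exists_approx`). If the algorithm does not stop, the values `ν(P_r)` are unbounded
since `R / m_R^n` is Artinian and `ν` has rank one (`exists_lt_value`).

The three generation statements are read off from this approximation. For minimality, a relation
expressing `ν(P_i)` or `in(P_i)`, `i ≥ 1`, through other generators involves only `P_j` with `j <
i`, which forces `n̄_i = 1` and, in the graded ring, also `α_i ∈ k(α_1, …, α_{i-1})`. For the
generators `ν(x)` and `in(x)` the assumption that `ν(x)` is the least value on `m_R` is needed:
if they are expressed through the others then `ν(x) = ν(y)`.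
-/

noncomputable section

namespace ValSemigroup

/-! ### Residues of elements of nonnegative value -/

section Residue

variable {R K Γ : Type*} [CommRing R] [Field K] [Algebra R K]
  [AddCommGroup Γ] [LinearOrder Γ] [IsOrderedAddMonoid Γ]
  {ν : AddValuation K (WithTop Γ)}

theorem valResidue_of_nonneg {z : K} (h : 0 ≤ ν z) :
    valResidue ν z = IsLocalRing.residue (valRing ν) ⟨z, mem_valRing.2 h⟩ := by
  unfold valResidue
  rw [dif_pos]

theorem valResidue_add {a b : K} (ha : 0 ≤ ν a) (hb : 0 ≤ ν b) :
    valResidue ν (a + b) = valResidue ν a + valResidue ν b := by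
  rw [valResidue_of_nonneg ha, valResidue_of_nonneg hb,
    valResidue_of_nonneg (AddValuation.map_le_add ν ha hb), ← map_add]
  rfl

theorem valResidue_mul {a b : K} (ha : 0 ≤ ν a) (hb : 0 ≤ ν b) :
    valResidue ν (a * b) = valResidue ν a * valResidue ν b := by
  have h : 0 ≤ ν (a * b) := by rw [AddValuation.map_mul]; exact add_nonneg ha hb
  rw [valResidue_of_nonneg ha, valResidue_of_nonneg hb, valResidue_of_nonneg h, ← map_mul]
  rfl

@[simp]
theorem valResidue_one : valResidue ν (1 : K) = 1 := by
  rw [valResidue_of_nonneg (by simp)]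
  exact map_one _

theorem valResidue_eq_zero {z : K} (h : 0 < ν z) : valResidue ν z = 0 := by
  rw [valResidue_of_nonneg h.le, IsLocalRing.residue_eq_zero_iff, IsLocalRing.mem_maximalIdeal,
    mem_nonunits_iff]
  intro hu
  obtain ⟨g, hg⟩ := isUnit_iff_exists_inv.1 hu
  have h1 : z * (g : K) = 1 := congrArg Subtype.val hg
  have h2 : ν z + ν (g : K) = 0 := by
    rw [← AddValuation.map_mul, h1, AddValuation.map_one]
  exact absurd h2 (ne_of_gt (add_pos_of_pos_of_nonneg h g.2))

@[simp]
theorem valResidue_zero : valResidue ν (0 : K) = 0 :=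
  valResidue_eq_zero (by simp)

theorem value_inv_eq_zero {z : K} (h : ν z = 0) : ν z⁻¹ = 0 := by
  have hz : z ≠ 0 := by
    rintro rfl
    simp at h
  have h2 : ν z + ν z⁻¹ = 0 := by
    rw [← AddValuation.map_mul, mul_inv_cancel₀ hz, AddValuation.map_one]
  rwa [h, zero_add] at h2

theorem valResidue_inv {z : K} (h : ν z = 0) : valResidue ν z⁻¹ = (valResidue ν z)⁻¹ := by
  have hz : z ≠ 0 := by
    rintro rfl
    simp at h
  refine eq_inv_of_mul_eq_one_left ?_
  rw [← valResidue_mul (value_inv_eq_zero h).ge h.ge, inv_mul_cancel₀ hz, valResidue_one]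

theorem valResidue_ne_zero {z : K} (h : ν z = 0) : valResidue ν z ≠ 0 := by
  have hz : z ≠ 0 := by
    rintro rfl
    simp at h
  intro h0
  have := valResidue_mul h.ge (value_inv_eq_zero h).ge
  rw [mul_inv_cancel₀ hz, valResidue_one, h0, zero_mul] at this
  exact one_ne_zero this

theorem value_pow_eq_zero {z : K} (h : ν z = 0) (n : ℕ) : ν (z ^ n) = 0 := by
  rw [AddValuation.map_pow, h, smul_zero]

theorem valResidue_pow {z : K} (h : 0 ≤ ν z) (n : ℕ) :
    valResidue ν (z ^ n) = valResidue ν z ^ n := by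
  induction n with
  | zero => simp
  | succ n ih =>
    rw [pow_succ, pow_succ, valResidue_mul _ h, ih]
    rw [AddValuation.map_pow]
    exact nsmul_nonneg h n

theorem value_zpow_eq_zero {z : K} (h : ν z = 0) (n : ℤ) : ν (z ^ n) = 0 := by
  cases n with
  | ofNat n =>
    rw [Int.ofNat_eq_natCast, zpow_natCast]
    exact value_pow_eq_zero h n
  | negSucc n =>
    rw [zpow_negSucc]
    exact value_inv_eq_zero (value_pow_eq_zero h _)

theorem valResidue_zpow {z : K} (h : ν z = 0) (n : ℤ) :
    valResidue ν (z ^ n) = valResidue ν z ^ n := by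
  cases n with
  | ofNat n => simpa using valResidue_pow h.ge n
  | negSucc n =>
    rw [zpow_negSucc, zpow_negSucc, valResidue_inv (value_pow_eq_zero h _), valResidue_pow h.ge]

theorem value_sum_nonneg {ι : Type*} (S : Finset ι) {f : ι → K} (h : ∀ k ∈ S, 0 ≤ ν (f k)) :
    0 ≤ ν (∑ k ∈ S, f k) :=
  AddValuation.map_le_sum ν h

theorem valResidue_sum {ι : Type*} (S : Finset ι) {f : ι → K} (h : ∀ k ∈ S, 0 ≤ ν (f k)) :
    valResidue ν (∑ k ∈ S, f k) = ∑ k ∈ S, valResidue ν (f k) := by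
  classical
  induction S using Finset.induction_on with
  | empty => simp
  | insert a S ha ih =>
    rw [Finset.sum_insert ha, Finset.sum_insert ha,
      valResidue_add (h a (Finset.mem_insert_self a S)), ih]
    · exact fun k hk => h k (Finset.mem_insert_of_mem hk)
    · exact value_sum_nonneg S fun k hk => h k (Finset.mem_insert_of_mem hk)

theorem value_pos_of_valResidue_eq_zero {z : K} (h : 0 ≤ ν z) (h0 : valResidue ν z = 0) :
    0 < ν z :=
  lt_of_le_of_ne h fun e => valResidue_ne_zero e.symm h0

theorem valResidue_algebraMap [IsLocalRing R] [Dominates R ν] (r : R) :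
    valResidue ν (algebraMap R K r) =
      algebraMap (IsLocalRing.ResidueField R) (ValResidueField ν) (IsLocalRing.residue R r) := by
  rw [valResidue_of_nonneg (Dominates.nonneg (ν := ν) r)]
  rfl

/-- Subtracting the value of `M ≠ 0` turns an inequality of values into one for quotients. -/
theorem value_div_nonneg {z M : K} (hM : M ≠ 0) (h : ν M ≤ ν z) : 0 ≤ ν (z / M) := by
  have hM' : ν M ≠ ⊤ := fun e => hM ((AddValuation.top_iff ν).1 e)
  have e : ν (z / M) + ν M = ν z := by
    rw [← AddValuation.map_mul, div_mul_cancel₀ _ hM]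
  rw [← e] at h
  lift ν M to Γ using hM' with m
  cases hz : ν (z / M) with
  | top => exact le_top
  | coe a =>
    rw [hz] at h
    have h' : m ≤ a + m := by exact_mod_cast h
    exact_mod_cast (le_add_iff_nonneg_left m).1 h'

theorem value_div_pos {z M : K} (hM : M ≠ 0) (h : ν M < ν z) : 0 < ν (z / M) := by
  refine lt_of_le_of_ne (value_div_nonneg hM h.le) fun e => h.ne ?_
  conv_rhs => rw [← div_mul_cancel₀ z hM, AddValuation.map_mul, ← e, zero_add]

theorem lt_value_of_div_pos {z M : K} (hM : M ≠ 0) (h : 0 < ν (z / M)) : ν M < ν z := by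
  have hM' : ν M ≠ ⊤ := fun e => hM ((AddValuation.top_iff ν).1 e)
  rw [← div_mul_cancel₀ z hM, AddValuation.map_mul]
  lift ν M to Γ using hM' with m
  cases hz : ν (z / M) with
  | top => simp
  | coe a =>
    rw [hz] at h
    have h' : 0 < a := by exact_mod_cast h
    exact_mod_cast lt_add_of_pos_left m h'

theorem value_div_eq_zero {z M : K} (hM : M ≠ 0) (h : ν z = ν M) : ν (z / M) = 0 := by
  refine le_antisymm ?_ (value_div_nonneg hM h.ge)
  by_contra hc
  push Not at hc
  have hM' : ν M ≠ ⊤ := fun e => hM ((AddValuation.top_iff ν).1 e)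
  have e : ν (z / M) + ν M = ν z := by
    rw [← AddValuation.map_mul, div_mul_cancel₀ _ hM]
  rw [h] at e
  lift ν M to Γ using hM' with m
  cases hz : ν (z / M) with
  | top => rw [hz, top_add] at e; exact WithTop.top_ne_coe e
  | coe a =>
    rw [hz] at e hc
    have e' : a + m = m := by exact_mod_cast e
    have hc' : 0 < a := by exact_mod_cast hc
    exact hc'.ne' (by simpa using e')

theorem value_algebraMap_eq_top_iff [IsDomain R] [IsFractionRing R K] {f : R} :
    ν (algebraMap R K f) = ⊤ ↔ f = 0 := by
  rw [AddValuation.top_iff]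
  exact IsFractionRing.to_map_eq_zero_iff

theorem exists_nsmul_value_gt (h : Nonempty (AddValuation.toValuation ν).RankOne) {a b : K}
    (ha : 0 < ν a) (hb : ν b ≠ ⊤) : ∃ n : ℕ, ν b < n • ν a := by
  obtain ⟨h⟩ := h
  set v := AddValuation.toValuation ν with hv
  have hval : ∀ z, v z = Multiplicative.ofAdd (OrderDual.toDual (ν z)) := fun z => rfl
  have h1 : Valuation.RankOne.hom v (v.restrict a) < 1 := by
    rw [← map_one (Valuation.RankOne.hom v)]
    apply Valuation.RankOne.strictMono v
    rw [← map_one v.restrict, Valuation.restrict_lt_iff, map_one]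
    exact ha
  have h2 : 0 < Valuation.RankOne.hom v (v.restrict b) := by
    rw [← map_zero (Valuation.RankOne.hom v)]
    apply Valuation.RankOne.strictMono v
    rw [← map_zero v.restrict, Valuation.restrict_lt_iff, map_zero]
    exact lt_top_iff_ne_top.2 hb
  obtain ⟨n, hn⟩ := exists_pow_lt_of_lt_one h2 h1
  refine ⟨n, ?_⟩
  rw [← map_pow, ← map_pow] at hn
  have h3 := (Valuation.RankOne.strictMono v).lt_iff_lt.1 hn
  rw [Valuation.restrict_lt_iff] at h3
  rw [← AddValuation.map_pow]
  exact h3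

end Residue

/-! ### Degrees of simple extensions -/

section FieldDegree

open IntermediateField

variable {F E : Type*} [Field F] [Field E] [Algebra F E] {A B : IntermediateField F E} {a : E}

theorem toENat_relrank_ne_zero : Cardinal.toENat (relrank A B) ≠ 0 := by
  rw [Ne, Cardinal.toENat_eq_zero, ← inf_relrank_right,
    relrank_eq_rank_of_le inf_le_right]
  exact (rank_pos).ne'

theorem toENat_relrank_eq_one_iff (h : B = A ⊔ F⟮a⟯) :
    Cardinal.toENat (relrank A B) = 1 ↔ a ∈ A := by
  rw [Cardinal.toENat_eq_one, relrank_eq_one_iff, h]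
  simp

theorem relrank_eq_rank_adjoin (h : B = A ⊔ F⟮a⟯) :
    relrank A B = Module.rank A A⟮a⟯ := by
  have hle : A ≤ B := h ▸ le_sup_left
  rw [relrank_eq_rank_of_le hle]
  have : extendScalars hle = A⟮a⟯ := by
    apply le_antisymm
    · have : B ≤ (A⟮a⟯).restrictScalars F := by
        rw [h, sup_le_iff]
        constructor
        · intro z hz
          exact (A⟮a⟯).algebraMap_mem ⟨z, hz⟩
        · rw [adjoin_simple_le_iff]
          exact mem_adjoin_simple_self A a
      exact this
    · rw [adjoin_simple_le_iff, mem_extendScalars, h]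
      exact (le_sup_right : F⟮a⟯ ≤ A ⊔ F⟮a⟯) (mem_adjoin_simple_self F a)
  rw [this]

theorem isIntegral_of_toENat_relrank_ne_top (h : B = A ⊔ F⟮a⟯)
    (ht : Cardinal.toENat (relrank A B) ≠ ⊤) : IsIntegral A a := by
  rw [relrank_eq_rank_adjoin h, Ne, Cardinal.toENat_eq_top, not_le] at ht
  have : FiniteDimensional A A⟮a⟯ := Module.rank_lt_aleph0_iff.1 ht
  exact isIntegral_iff.1 (IsIntegral.of_finite A (⟨a, mem_adjoin_simple_self A a⟩ : A⟮a⟯))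

theorem natDegree_minpoly_eq_toENat_relrank (h : B = A ⊔ F⟮a⟯) (ha : IsIntegral A a) :
    ((minpoly A a).natDegree : ℕ∞) = Cardinal.toENat (relrank A B) := by
  rw [relrank_eq_rank_adjoin h]
  have : FiniteDimensional A A⟮a⟯ := adjoin.finiteDimensional ha
  rw [← adjoin.finrank ha, ← Module.finrank_eq_rank, Cardinal.toENat_nat]

/-- The powers `1, a, a², …` with exponents below the degree `[A(a) : A]` are linearly
independent over `A`, also when the degree is infinite. -/
theorem eq_zero_of_natDegree_lt_relrank (h : B = A ⊔ F⟮a⟯) {p : Polynomial A}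
    (hp : (p.natDegree : ℕ∞) < Cardinal.toENat (relrank A B)) (h0 : Polynomial.aeval a p = 0) :
    p = 0 := by
  by_contra hne
  have hint : IsIntegral A a := isAlgebraic_iff_isIntegral.1 ⟨p, hne, h0⟩
  rw [← natDegree_minpoly_eq_toENat_relrank h hint, Nat.cast_lt] at hp
  exact hp.not_ge (Polynomial.natDegree_le_natDegree (minpoly.degree_le_of_ne_zero A a hne h0))

end FieldDegree

/-! ### Laurent monomials and the independence of residues -/

section Laurent

section Values

variable {Γ : Type*} [AddCommGroup Γ]

/-- The value `e_0 γ_0 + ⋯ + e_{n-1} γ_{n-1}` of a Laurent monomial. -/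
def lval (γ : ℕ → Γ) (e : ℕ → ℤ) (n : ℕ) : Γ :=
  ∑ s ∈ Finset.range n, e s • γ s

theorem lval_add (γ : ℕ → Γ) (e f : ℕ → ℤ) (n : ℕ) :
    lval γ (e + f) n = lval γ e n + lval γ f n := by
  simp [lval, add_smul, Finset.sum_add_distrib]

theorem lval_sub (γ : ℕ → Γ) (e f : ℕ → ℤ) (n : ℕ) :
    lval γ (e - f) n = lval γ e n - lval γ f n := by
  simp [lval, sub_smul, Finset.sum_sub_distrib]

theorem lval_zsmul (γ : ℕ → Γ) (t : ℤ) (e : ℕ → ℤ) (n : ℕ) :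
    lval γ (t • e) n = t • lval γ e n := by
  simp [lval, mul_smul, Finset.smul_sum]

theorem lval_succ (γ : ℕ → Γ) (e : ℕ → ℤ) (n : ℕ) :
    lval γ e (n + 1) = lval γ e n + e n • γ n :=
  Finset.sum_range_succ _ _

end Values

variable {R K Γ : Type*} [CommRing R] [Field K] [Algebra R K]
  [AddCommGroup Γ] [LinearOrder Γ] [IsOrderedAddMonoid Γ]

variable (K) in
/-- The Laurent monomial `P_0^{e_0} ⋯ P_{n-1}^{e_{n-1}}` in `K`. -/
def lmon (P : ℕ → R) (e : ℕ → ℤ) (n : ℕ) : K :=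
  ∏ s ∈ Finset.range n, algebraMap R K (P s) ^ e s

theorem lmon_succ (P : ℕ → R) (e : ℕ → ℤ) (n : ℕ) :
    lmon K P e (n + 1) = lmon K P e n * algebraMap R K (P n) ^ e n :=
  Finset.prod_range_succ _ _

theorem lmon_natCast (P : ℕ → R) (σ : ℕ → ℕ) (n : ℕ) :
    lmon K P (fun s => (σ s : ℤ)) n = algebraMap R K (∏ s ∈ Finset.range n, P s ^ σ s) := by
  simp [lmon, map_prod]

theorem lmon_ne_zero {P : ℕ → R} {n : ℕ} (h : ∀ s < n, algebraMap R K (P s) ≠ 0) (e : ℕ → ℤ) :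
    lmon K P e n ≠ 0 :=
  Finset.prod_ne_zero_iff.2 fun s hs => zpow_ne_zero _ (h s (Finset.mem_range.1 hs))

theorem lmon_add {P : ℕ → R} {n : ℕ} (h : ∀ s < n, algebraMap R K (P s) ≠ 0) (e f : ℕ → ℤ) :
    lmon K P (e + f) n = lmon K P e n * lmon K P f n := by
  rw [lmon, lmon, lmon, ← Finset.prod_mul_distrib]
  exact Finset.prod_congr rfl fun s hs => zpow_add₀ (h s (Finset.mem_range.1 hs)) _ _

theorem lmon_sub {P : ℕ → R} {n : ℕ} (h : ∀ s < n, algebraMap R K (P s) ≠ 0) (e f : ℕ → ℤ) :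
    lmon K P (e - f) n = lmon K P e n / lmon K P f n := by
  rw [lmon, lmon, lmon, ← Finset.prod_div_distrib]
  exact Finset.prod_congr rfl fun s hs => zpow_sub₀ (h s (Finset.mem_range.1 hs)) _ _

theorem lmon_zsmul (P : ℕ → R) (t : ℤ) (e : ℕ → ℤ) (n : ℕ) :
    lmon K P (t • e) n = lmon K P e n ^ t := by
  rw [lmon, lmon, ← Finset.prod_zpow]
  refine Finset.prod_congr rfl fun s _ => ?_
  rw [Pi.smul_apply, smul_eq_mul, mul_comm, zpow_mul]

variable {ν : AddValuation K (WithTop Γ)}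

theorem value_zpow {z : K} {g : Γ} (h : ν z = g) (m : ℤ) :
    ν (z ^ m) = ((m • g : Γ) : WithTop Γ) := by
  have hz : z ≠ 0 := by
    rintro rfl
    simp at h
  cases m with
  | ofNat n =>
    rw [Int.ofNat_eq_natCast, zpow_natCast, AddValuation.map_pow, h, natCast_zsmul,
      WithTop.coe_nsmul]
  | negSucc n =>
    have h1 : ν (z ^ Int.negSucc n) + ν (z ^ (n + 1)) = 0 := by
      rw [← AddValuation.map_mul, zpow_negSucc, inv_mul_cancel₀ (pow_ne_zero _ hz),
        AddValuation.map_one]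
    rw [AddValuation.map_pow, h, ← WithTop.coe_nsmul] at h1
    cases ha : ν (z ^ Int.negSucc n) with
    | top => rw [ha] at h1; simp at h1
    | coe a =>
      rw [ha] at h1
      have h2 : a + (n + 1) • g = 0 := by exact_mod_cast h1
      rw [negSucc_zsmul, eq_neg_of_add_eq_zero_left h2]

theorem value_lmon {P : ℕ → R} {γ : ℕ → Γ} {n : ℕ}
    (h : ∀ s < n, ν (algebraMap R K (P s)) = (γ s : WithTop Γ)) (e : ℕ → ℤ) :
    ν (lmon K P e n) = ((lval γ e n : Γ) : WithTop Γ) := by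
  induction n with
  | zero => simp [lmon, lval]
  | succ n ih =>
    rw [lmon_succ, lval_succ, AddValuation.map_mul, ih fun s hs => h s (hs.trans n.lt_succ_self),
      value_zpow (h n n.lt_succ_self), WithTop.coe_add]

end Laurent

section Index

variable {R K Γ : Type*} [CommRing R] [Field K] [Algebra R K]
  [AddCommGroup Γ] [LinearOrder Γ] [IsOrderedAddMonoid Γ]
  {ν : AddValuation K (WithTop Γ)} {P : ℕ → R} {γ : ℕ → Γ} {i : ℕ}

theorem mem_valGroup {j : ℕ} (hj : j ≤ i) (h : ν (algebraMap R K (P j)) = (γ j : WithTop Γ)) :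
    γ j ∈ valGroup ν P i :=
  AddSubgroup.subset_closure ⟨j, hj, h⟩

theorem valGroup_mono {j : ℕ} (hj : j ≤ i) : valGroup ν P j ≤ valGroup ν P i :=
  AddSubgroup.closure_mono fun _ ⟨s, hs, h⟩ => ⟨s, hs.trans hj, h⟩

theorem lval_mem_valGroup (h : ∀ j ≤ i, ν (algebraMap R K (P j)) = (γ j : WithTop Γ))
    (e : ℕ → ℤ) : lval γ e (i + 1) ∈ valGroup ν P i :=
  sum_mem fun s hs => zsmul_mem
    (mem_valGroup (Nat.lt_succ_iff.1 (Finset.mem_range.1 hs))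
      (h s (Nat.lt_succ_iff.1 (Finset.mem_range.1 hs)))) _

theorem nbar_ne_zero : nbar ν P i ≠ 0 := by
  rw [nbar, Ne, ENat.card_eq_zero_iff_empty]
  exact not_isEmpty_of_nonempty _

theorem valGroup_succ (h : ν (algebraMap R K (P (i + 1))) = (γ (i + 1) : WithTop Γ)) :
    valGroup ν P (i + 1) = valGroup ν P i ⊔ AddSubgroup.zmultiples (γ (i + 1)) := by
  apply le_antisymm
  · rw [valGroup, AddSubgroup.closure_le]
    rintro g ⟨j, hj, hg⟩
    rcases hj.lt_or_eq with hj | rfl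
    · exact (le_sup_left : valGroup ν P i ≤ _)
        (AddSubgroup.subset_closure ⟨j, Nat.lt_succ_iff.1 hj, hg⟩)
    · rw [h] at hg
      obtain rfl := WithTop.coe_injective hg
      exact (le_sup_right : AddSubgroup.zmultiples (γ (i + 1)) ≤ _)
        (AddSubgroup.mem_zmultiples _)
  · rw [sup_le_iff, AddSubgroup.zmultiples_le]
    exact ⟨valGroup_mono i.le_succ, mem_valGroup le_rfl h⟩

/-- The multiples of `ν(P_{i+1})` in `G(ν(P_0), …, ν(P_i))` are those by the multiples of
`n̄_{i+1}`.  Since `⊤.toNat = 0`, this includes the case `n̄_{i+1} = ∞`. -/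
theorem zsmul_mem_valGroup_iff (h : ν (algebraMap R K (P (i + 1))) = (γ (i + 1) : WithTop Γ))
    (m : ℤ) : m • γ (i + 1) ∈ valGroup ν P i ↔ ((nbar ν P (i + 1)).toNat : ℤ) ∣ m := by
  set H := (valGroup ν P i).addSubgroupOf (valGroup ν P (i + 1)) with hH
  let g' : valGroup ν P (i + 1) := ⟨γ (i + 1), mem_valGroup le_rfl h⟩
  let g : valGroup ν P (i + 1) ⧸ H := QuotientAddGroup.mk g'
  have hg : AddSubgroup.zmultiples g = ⊤ := by
    rw [eq_top_iff]
    rintro q -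
    obtain ⟨⟨a, ha⟩, rfl⟩ := QuotientAddGroup.mk_surjective q
    have ha' := ha
    rw [valGroup_succ h, AddSubgroup.mem_sup] at ha'
    obtain ⟨b, hb, c, hc, rfl⟩ := ha'
    obtain ⟨m, rfl⟩ := AddSubgroup.mem_zmultiples_iff.1 hc
    refine AddSubgroup.mem_zmultiples_iff.2 ⟨m, ?_⟩
    change QuotientAddGroup.mk (m • g') = _
    rw [QuotientAddGroup.eq, hH, AddSubgroup.mem_addSubgroupOf]
    simpa [g'] using hb
  have hN : (nbar ν P (i + 1)).toNat = addOrderOf g := by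
    rw [← Nat.card_zmultiples, hg]
    simp only [nbar, Nat.add_sub_cancel]
    rw [Nat.card_congr (AddSubgroup.topEquiv (G := valGroup ν P (i + 1) ⧸ H)).toEquiv]
    rfl
  rw [hN, addOrderOf_dvd_iff_zsmul_eq_zero]
  change _ ↔ ((m • g' : valGroup ν P (i + 1)) : valGroup ν P (i + 1) ⧸ H) = 0
  rw [QuotientAddGroup.eq_zero_iff, hH, AddSubgroup.mem_addSubgroupOf]
  rfl

theorem nbar_succ_eq_one (h : ν (algebraMap R K (P (i + 1))) = (γ (i + 1) : WithTop Γ))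
    (hmem : γ (i + 1) ∈ valGroup ν P i) : nbar ν P (i + 1) = 1 := by
  have h1 := (zsmul_mem_valGroup_iff h 1).1 (by rwa [one_smul])
  have h2 : (nbar ν P (i + 1)).toNat = 1 :=
    Nat.dvd_one.1 (Int.natCast_dvd_natCast.1 (by exact_mod_cast h1))
  exact (ENat.toNat_eq_iff one_ne_zero).1 h2

variable (ν P) in
/-- The value of `P_j` as an element of `Γ`. -/
def genVal (j : ℕ) : Γ :=
  (ν (algebraMap R K (P j))).untopD 0

theorem genVal_spec {j : ℕ} (h : ν (algebraMap R K (P j)) ≠ ⊤) :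
    ν (algebraMap R K (P j)) = ((genVal ν P j : Γ) : WithTop Γ) := by
  obtain ⟨g, hg⟩ := WithTop.ne_top_iff_exists.1 h
  simp [genVal, ← hg]

end Index

section Alpha

variable {R K Γ : Type*} [CommRing R] [Field K] [Algebra R K]
  [AddCommGroup Γ] [LinearOrder Γ] [IsOrderedAddMonoid Γ]
  (ν : AddValuation K (WithTop Γ)) (P : ℕ → R) (w : ℕ → ℕ → ℕ)

/-- The exponents of the monomial `U_i`, and `0` if `n̄_i = ∞`; with this choice
`P_i^{n̄_i} / U_i` makes sense in both cases, its exponent of `P_i` being `⊤.toNat = 0` in the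
second. -/
def uexp (i : ℕ) : ℕ → ℤ :=
  open Classical in if nbar ν P i = ⊤ then 0 else fun s => (w i s : ℤ)

/-- The element `P_i^{n̄_i} / U_i` of `K`, whose residue is `α_i`, and `1` if `n̄_i = ∞`. -/
def alphaLift (i : ℕ) : K :=
  algebraMap R K (P i) ^ (nbar ν P i).toNat / lmon K P (uexp ν P w i) i

theorem alpha_eq (i : ℕ) : alpha ν P w i = valResidue ν (alphaLift ν P w i) := by
  unfold alpha alphaLift uexp
  split_ifs with h
  · rw [h]
    simp [lmon]
  · rw [lmon_natCast, monU]

/-- `P_0, …, P_i` are nonzero elements of the maximal ideal with values `γ_0, …, γ_i`, and the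
monomials `U_1, …, U_i` have the values required by the algorithm. -/
structure HasValues (γ : ℕ → Γ) (i : ℕ) : Prop where
  value_eq : ∀ j ≤ i, ν (algebraMap R K (P j)) = (γ j : WithTop Γ)
  pos : ∀ j ≤ i, 0 < γ j
  value_monU : ∀ j, 1 ≤ j → j ≤ i → nbar ν P j ≠ ⊤ →
    ν (algebraMap R K (P j ^ (nbar ν P j).toNat)) = ν (algebraMap R K (monU P w j))

variable {ν P w} {γ : ℕ → Γ} {i : ℕ}

theorem HasValues.mono (h : HasValues ν P w γ i) {j : ℕ} (hj : j ≤ i) : HasValues ν P w γ j where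
  value_eq s hs := h.value_eq s (hs.trans hj)
  pos s hs := h.pos s (hs.trans hj)
  value_monU s hs hs' := h.value_monU s hs (hs'.trans hj)

theorem HasValues.ne_zero (h : HasValues ν P w γ i) {j : ℕ} (hj : j ≤ i) :
    algebraMap R K (P j) ≠ 0 := by
  intro h0
  have := h.value_eq j hj
  rw [h0] at this
  simp at this

theorem HasValues.lval_uexp (h : HasValues ν P w γ (i + 1)) :
    lval γ (uexp ν P w (i + 1)) (i + 1) = ((nbar ν P (i + 1)).toNat : ℤ) • γ (i + 1) := by
  unfold uexp
  split_ifs with ht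
  · simp [ht, lval]
  · have h1 := h.value_monU (i + 1) (by omega) le_rfl ht
    rw [monU, ← lmon_natCast, value_lmon fun s hs => h.value_eq s (by omega), map_pow,
      AddValuation.map_pow, h.value_eq _ le_rfl, ← WithTop.coe_nsmul] at h1
    rw [natCast_zsmul]
    exact (WithTop.coe_injective h1).symm

theorem HasValues.value_alphaLift (h : HasValues ν P w γ (i + 1)) :
    ν (alphaLift ν P w (i + 1)) = 0 := by
  refine value_div_eq_zero (lmon_ne_zero (fun s hs => h.ne_zero (by omega)) _) ?_
  rw [value_lmon (fun s hs => h.value_eq s (by omega)), h.lval_uexp, AddValuation.map_pow,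
    h.value_eq _ le_rfl, natCast_zsmul, WithTop.coe_nsmul]

theorem HasValues.dvd_of_lval_eq_zero (h : HasValues ν P w γ (i + 1)) {e : ℕ → ℤ}
    (he : lval γ e (i + 2) = 0) : ((nbar ν P (i + 1)).toNat : ℤ) ∣ e (i + 1) := by
  rw [← zsmul_mem_valGroup_iff (h.value_eq _ le_rfl)]
  rw [lval_succ, add_comm] at he
  rw [eq_neg_of_add_eq_zero_left he]
  exact neg_mem (lval_mem_valGroup (fun j hj => h.value_eq j (by omega)) e)

theorem HasValues.lval_add_smul_uexp (h : HasValues ν P w γ (i + 1)) {e : ℕ → ℤ} {t : ℤ}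
    (ht : e (i + 1) = (nbar ν P (i + 1)).toNat * t) :
    lval γ (e + t • uexp ν P w (i + 1)) (i + 1) = lval γ e (i + 2) := by
  rw [lval_add, lval_zsmul, h.lval_uexp, lval_succ _ _ (i + 1), ht, ← mul_smul, mul_comm]

/-- A Laurent monomial whose exponent of `P_{i+1}` is `n̄_{i+1} t` is the `t`-th power of
`P_{i+1}^{n̄_{i+1}} / U_{i+1}` times a Laurent monomial in `P_0, …, P_i`. -/
theorem HasValues.lmon_eq (h : HasValues ν P w γ (i + 1)) {e : ℕ → ℤ} {t : ℤ}
    (ht : e (i + 1) = (nbar ν P (i + 1)).toNat * t) :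
    lmon K P e (i + 2) =
      alphaLift ν P w (i + 1) ^ t * lmon K P (e + t • uexp ν P w (i + 1)) (i + 1) := by
  have h0 : ∀ s < i + 1, algebraMap R K (P s) ≠ 0 := fun s hs => h.ne_zero (by omega)
  have h1 : lmon K P (uexp ν P w (i + 1)) (i + 1) ^ t ≠ 0 := zpow_ne_zero _ (lmon_ne_zero h0 _)
  rw [lmon_add h0, lmon_zsmul, alphaLift, div_zpow, lmon_succ P e (i + 1), ht, zpow_mul,
    zpow_natCast]
  field_simp

end Alpha

section Residues

variable {R K Γ : Type*} [CommRing R] [IsLocalRing R] [Field K] [Algebra R K]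
  [AddCommGroup Γ] [LinearOrder Γ] [IsOrderedAddMonoid Γ]
  {ν : AddValuation K (WithTop Γ)} {P : ℕ → R} {w : ℕ → ℕ → ℕ} {γ : ℕ → Γ} {i : ℕ}
  [Dominates R ν]

open IntermediateField in
theorem alphaField_succ : alphaField ν P w (i + 1) =
    alphaField ν P w i ⊔ adjoin (IsLocalRing.ResidueField R) {alpha ν P w (i + 1)} := by
  rw [alphaField, alphaField, ← adjoin_union]
  congr 1
  ext a
  constructor
  · rintro ⟨j, hj, hj', rfl⟩
    rcases hj'.lt_or_eq with hj' | rfl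
    · exact Or.inl ⟨j, hj, by omega, rfl⟩
    · exact Or.inr rfl
  · rintro (⟨j, hj, hj', rfl⟩ | rfl)
    · exact ⟨j, hj, by omega, rfl⟩
    · exact ⟨i + 1, by omega, le_rfl, rfl⟩

theorem alphaField_mono {j : ℕ} (hj : j ≤ i) : alphaField ν P w j ≤ alphaField ν P w i :=
  IntermediateField.adjoin.mono _ _ _ fun _ ⟨s, h1, h2, h3⟩ => ⟨s, h1, h2.trans hj, h3⟩

theorem alpha_mem_alphaField : alpha ν P w (i + 1) ∈ alphaField ν P w (i + 1) :=
  IntermediateField.subset_adjoin _ _ ⟨i + 1, by omega, le_rfl, rfl⟩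

theorem deg_succ_eq_one_iff : deg ν P w (i + 1) = 1 ↔ alpha ν P w (i + 1) ∈ alphaField ν P w i :=
  toENat_relrank_eq_one_iff alphaField_succ

theorem deg_ne_zero : deg ν P w i ≠ 0 :=
  toENat_relrank_ne_zero

/-- The residue of a Laurent monomial of value zero in `P_0, …, P_i` lies in `k(α_1, …, α_i)`. -/
theorem HasValues.valResidue_lmon_mem (h : HasValues ν P w γ i) {e : ℕ → ℤ}
    (he : lval γ e (i + 1) = 0) : valResidue ν (lmon K P e (i + 1)) ∈ alphaField ν P w i := by
  induction i generalizing e with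
  | zero =>
    have h0 : e 0 = 0 := by
      have h1 : e 0 • γ 0 = 0 := by simpa [lval] using he
      exact (smul_eq_zero.1 h1).resolve_right (h.pos 0 le_rfl).ne'
    have h1 : lmon K P e (0 + 1) = 1 := by simp [lmon, h0]
    rw [h1, valResidue_one]
    exact one_mem _
  | succ i ih =>
    obtain ⟨t, ht⟩ := h.dvd_of_lval_eq_zero he
    have h1 := h.lval_add_smul_uexp ht
    rw [he] at h1
    have h2 := value_lmon (fun s hs => h.value_eq s (by omega))
      (e + t • uexp ν P w (i + 1)) (n := i + 1)
    rw [h1, WithTop.coe_zero] at h2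
    rw [h.lmon_eq ht, valResidue_mul (value_zpow_eq_zero h.value_alphaLift t).ge h2.ge,
      valResidue_zpow h.value_alphaLift, ← alpha_eq]
    exact mul_mem (zpow_mem alpha_mem_alphaField t)
      (alphaField_mono i.le_succ (ih (h.mono i.le_succ) h1))

/-- The residues of pairwise distinct reduced monomials in `P_0, …, P_i` of the same value, divided
by a Laurent monomial of that value, are linearly independent over `k`: the exponents of `P_i` are
congruent modulo `n̄_i`, which leaves distinct powers of `α_i` with exponents in a range of length
`d_i`, and their coefficients are residues in `k(α_1, …, α_{i-1})`. -/
theorem HasValues.coeff_eq_zero (h : HasValues ν P w γ i) {ι : Type*} (S : Finset ι)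
    (σ : ι → ℕ → ℕ) (a : ι → IsLocalRing.ResidueField R) (e : ℕ → ℤ)
    (hred : ∀ k ∈ S, ∀ s, 1 ≤ s → s ≤ i → (σ k s : ℕ∞) < nn ν P w s)
    (hval : ∀ k ∈ S, lval γ ((fun s => (σ k s : ℤ)) - e) (i + 1) = 0)
    (hinj : ∀ k ∈ S, ∀ l ∈ S, (∀ s ≤ i, σ k s = σ l s) → k = l)
    (hsum : ∑ k ∈ S, algebraMap _ (ValResidueField ν) (a k) *
      valResidue ν (lmon K P ((fun s => (σ k s : ℤ)) - e) (i + 1)) = 0) :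
    ∀ k ∈ S, a k = 0 := by
  classical
  induction i generalizing S e with
  | zero =>
    have h0 : ∀ k ∈ S, (σ k 0 : ℤ) = e 0 := by
      intro k hk
      have h1 : ((σ k 0 : ℤ) - e 0) • γ 0 = 0 := by simpa [lval] using hval k hk
      exact sub_eq_zero.1 ((smul_eq_zero.1 h1).resolve_right (h.pos 0 le_rfl).ne')
    intro k hk
    have hS : S = {k} := by
      refine Finset.eq_singleton_iff_unique_mem.2 ⟨hk, fun l hl => hinj l hl k hk ?_⟩
      intro s hs
      obtain rfl : s = 0 := by omega
      exact_mod_cast (h0 l hl).trans (h0 k hk).symm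
    have h1 : lmon K P ((fun s => (σ k s : ℤ)) - e) (0 + 1) = 1 := by simp [lmon, h0 k hk]
    rw [hS, Finset.sum_singleton, h1, valResidue_one, mul_one] at hsum
    exact (map_eq_zero _).1 hsum
  | succ i ih =>
    set N := (nbar ν P (i + 1)).toNat with hN
    set A := alphaField ν P w i with hA
    set α := alpha ν P w (i + 1) with hα
    have hα0 : α ≠ 0 := by
      rw [hα, alpha_eq]
      exact valResidue_ne_zero h.value_alphaLift
    -- the exponents of `P_{i+1}` are `N q_k + r` with the remainder `r` of `e_{i+1}` modulo `N`
    let q : ι → ℕ := fun k => σ k (i + 1) / N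
    let t : ι → ℤ := fun k => q k - e (i + 1) / N
    have hmod : ∀ k ∈ S, (σ k (i + 1) : ℤ) % N = e (i + 1) % N := by
      intro k hk
      exact (Int.modEq_iff_dvd.2 (h.dvd_of_lval_eq_zero (hval k hk))).symm
    have ht : ∀ k ∈ S, ((fun s => (σ k s : ℤ)) - e) (i + 1) = N * t k := by
      intro k hk
      have h1 := Int.mul_ediv_add_emod (σ k (i + 1)) N
      have h2 := Int.mul_ediv_add_emod (e (i + 1)) N
      have h3 := hmod k hk
      change (σ k (i + 1) : ℤ) - e (i + 1) = N * (((σ k (i + 1) / N : ℕ) : ℤ) - e (i + 1) / N)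
      push_cast
      linear_combination -h1 + h2 + h3
    have hq : ∀ k ∈ S, (q k : ℕ∞) < deg ν P w (i + 1) := by
      intro k hk
      rcases Nat.eq_zero_or_pos N with h0 | h0
      · simp only [q, h0, Nat.div_zero, Nat.cast_zero]
        exact pos_iff_ne_zero.2 deg_ne_zero
      · have htop : nbar ν P (i + 1) ≠ ⊤ := by
          intro ht
          rw [hN, ht] at h0
          simp at h0
        have h1 := hred k hk (i + 1) (by omega) le_rfl
        rw [nn, ← ENat.natCast_toNat htop, ← hN] at h1
        by_cases hd : deg ν P w (i + 1) = ⊤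
        · rw [hd]
          exact ENat.natCast_lt_top _
        · rw [← ENat.natCast_toNat hd] at h1 ⊢
          exact_mod_cast Nat.div_lt_of_lt_mul (by exact_mod_cast h1)
    let f : ι → ℕ → ℤ := fun k => (fun s => (σ k s : ℤ)) - e + t k • uexp ν P w (i + 1)
    have hf : ∀ k ∈ S, lval γ (f k) (i + 1) = 0 := fun k hk =>
      (h.lval_add_smul_uexp (ht k hk)).trans (hval k hk)
    have hfν : ∀ k ∈ S, ν (lmon K P (f k) (i + 1)) = 0 := by
      intro k hk
      rw [value_lmon (fun s hs => h.value_eq s (by omega)), hf k hk, WithTop.coe_zero]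
    have hκ : ∀ k, ∃ c : A, k ∈ S → (c : ValResidueField ν) =
        valResidue ν (lmon K P (f k) (i + 1)) := by
      intro k
      by_cases hk : k ∈ S
      · exact ⟨⟨_, (h.mono i.le_succ).valResidue_lmon_mem (hf k hk)⟩, fun _ => rfl⟩
      · exact ⟨0, fun hk' => absurd hk' hk⟩
    choose κ hκ using hκ
    have hres : ∀ k ∈ S, valResidue ν (lmon K P ((fun s => (σ k s : ℤ)) - e) (i + 2)) =
        α ^ q k * α ^ (-(e (i + 1) / N)) * κ k := by
      intro k hk
      rw [h.lmon_eq (ht k hk),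
        valResidue_mul (value_zpow_eq_zero h.value_alphaLift _).ge (hfν k hk).ge,
        valResidue_zpow h.value_alphaLift, ← alpha_eq, hκ k hk, ← zpow_natCast, ← zpow_add₀ hα0]
      rfl
    let p : Polynomial A := ∑ k ∈ S, Polynomial.monomial (q k) (algebraMap _ A (a k) * κ k)
    have hp0 : Polynomial.aeval α p = 0 := by
      have h1 : α ^ (-(e (i + 1) / N)) * Polynomial.aeval α p = 0 := by
        rw [← hsum, map_sum, Finset.mul_sum]
        refine Finset.sum_congr rfl fun k hk => ?_
        rw [hres k hk, Polynomial.aeval_monomial, map_mul,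
          ← IsScalarTower.algebraMap_apply]
        change _ * (_ * (κ k : ValResidueField ν) * _) = _
        ring
      exact (mul_eq_zero.1 h1).resolve_left (zpow_ne_zero _ hα0)
    intro k₀ hk₀
    have hdeg : (p.natDegree : ℕ∞) < deg ν P w (i + 1) := by
      obtain ⟨l, hl, hl'⟩ := Finset.exists_mem_eq_sup S ⟨k₀, hk₀⟩ q
      refine lt_of_le_of_lt ?_ (hq l hl)
      rw [Nat.cast_le]
      refine Polynomial.natDegree_sum_le_of_forall_le S _ fun k hk => ?_
      exact (Polynomial.natDegree_monomial_le _).trans (hl' ▸ Finset.le_sup hk)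
    have hp : p = 0 := eq_zero_of_natDegree_lt_relrank alphaField_succ hdeg hp0
    refine ih (h.mono i.le_succ) (S.filter fun k => q k = q k₀)
      (e - t k₀ • uexp ν P w (i + 1)) ?_ ?_ ?_ ?_ k₀ (Finset.mem_filter.2 ⟨hk₀, rfl⟩)
    · exact fun k hk s hs hs' => hred k (Finset.mem_filter.1 hk).1 s hs (by omega)
    · intro k hk
      obtain ⟨hk, hkq⟩ := Finset.mem_filter.1 hk
      have : t k = t k₀ := by simp only [t, hkq]
      rw [← this, sub_sub_eq_add_sub, add_sub_right_comm]
      exact hf k hk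
    · intro k hk l hl hkl
      obtain ⟨hk, hkq⟩ := Finset.mem_filter.1 hk
      obtain ⟨hl, hlq⟩ := Finset.mem_filter.1 hl
      refine hinj k hk l hl fun s hs => ?_
      rcases hs.lt_or_eq with hs | rfl
      · exact hkl s (by omega)
      · have h1 := ht k hk
        have h2 := ht l hl
        have h3 : t k = t l := by simp only [t, hkq, hlq]
        simp only [Pi.sub_apply, h3] at h1 h2
        omega
    · have h1 : p.coeff (q k₀) = 0 := by rw [hp, Polynomial.coeff_zero]
      simp only [p, Polynomial.finsetSum_coeff, Polynomial.coeff_monomial] at h1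
      rw [← Finset.sum_filter] at h1
      have h2 := congrArg (algebraMap A (ValResidueField ν)) h1
      rw [map_zero, map_sum] at h2
      rw [← h2]
      refine Finset.sum_congr rfl fun k hk => ?_
      obtain ⟨hk, hkq⟩ := Finset.mem_filter.1 hk
      have : t k = t k₀ := by simp only [t, hkq]
      rw [map_mul, ← IsScalarTower.algebraMap_apply, ← this, sub_sub_eq_add_sub,
        add_sub_right_comm]
      exact congrArg _ (hκ k hk).symm

end Residues

/-! ### Values along the algorithm -/

section Dimension

variable {R : Type*} [CommRing R] [IsLocalRing R] [IsNoetherianRing R]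

/-- In a two-dimensional local ring with maximal ideal `(x, y)` no power of `y` is a multiple of
`x`, by Krull's principal ideal theorem. -/
theorem pow_notMem_span_singleton (hdim : ringKrullDim R = 2) {x y : R}
    (hxy : IsLocalRing.maximalIdeal R = Ideal.span {x, y}) (b : ℕ) :
    y ^ b ∉ Ideal.span {x} := by
  intro hb
  have hx : x ∈ IsLocalRing.maximalIdeal R := hxy ▸ Ideal.subset_span (by simp)
  have hmin : IsLocalRing.maximalIdeal R ∈ (Ideal.span {x}).minimalPrimes := by
    refine ⟨⟨inferInstance, (Ideal.span_singleton_le_iff_mem _).2 hx⟩, ?_⟩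
    rintro p ⟨hp, hxp⟩ -
    rw [hxy, Ideal.span_le]
    rintro z (rfl | rfl)
    · exact hxp (Ideal.mem_span_singleton_self _)
    · exact hp.mem_of_pow_mem b (hxp hb)
  have h1 := Ideal.height_le_one_of_isPrincipal_of_mem_minimalPrimes _ _ hmin
  have h2 := IsLocalRing.maximalIdeal_height_eq_ringKrullDim (R := R)
  rw [hdim] at h2
  have h3 : (IsLocalRing.maximalIdeal R).height = 2 := WithBot.coe_injective h2
  rw [h3] at h1
  exact absurd h1 (by decide)

end Dimension

section Step

variable {R K Γ : Type*} [CommRing R] [IsLocalRing R] [Field K] [Algebra R K]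
  [AddCommGroup Γ] [LinearOrder Γ] [IsOrderedAddMonoid Γ]
  {ν : AddValuation K (WithTop Γ)} {P : ℕ → R} {w : ℕ → ℕ → ℕ} {γ : ℕ → Γ} {i : ℕ}
  [Dominates R ν]

/-- The value of `P_{i+1}` jumps above `n_i ν(P_i)`: the residue of `P_{i+1} / U_i^{d_i}` is the
value at `α_i` of its own minimal polynomial. -/
theorem HasValues.value_lt_of_isStep (h : HasValues ν P w γ (i + 1)) {CS : Set R}
    (hn : nbar ν P (i + 1) ≠ ⊤) (hd : deg ν P w (i + 1) ≠ ⊤) (hs : IsStep ν CS P w (i + 1)) :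
    ν (algebraMap R K (P (i + 1) ^ (nn ν P w (i + 1)).toNat)) < ν (algebraMap R K (P (i + 2))) := by
  obtain ⟨l, c, σ, -, hred, hval, hP, hcoeff⟩ := hs
  set N := (nbar ν P (i + 1)).toNat with hN
  set d := (deg ν P w (i + 1)).toNat with hd'
  have hnn : (nn ν P w (i + 1)).toNat = N * d := by rw [nn, ENat.toNat_mul]
  have hNpos : 0 < N := Nat.pos_of_ne_zero fun e =>
    (ENat.toNat_eq_zero.1 e).elim nbar_ne_zero hn
  rw [hnn] at hval hP ⊢
  set U := algebraMap R K (monU P w (i + 1)) with hU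
  set A := alphaField ν P w i with hA
  set α := alpha ν P w (i + 1) with hα
  set z := alphaLift ν P w (i + 1) with hz
  have hzU : z = algebraMap R K (P (i + 1)) ^ N / U := by
    rw [hz, alphaLift, uexp, if_neg hn, lmon_natCast]
    rfl
  have hzν : ν z = 0 := h.value_alphaLift
  have hU0 : U ≠ 0 := by
    rw [hU, monU, ← lmon_natCast]
    exact lmon_ne_zero (fun s hs => h.ne_zero (by omega)) _
  have hUν : ν U = ν (algebraMap R K (P (i + 1)) ^ N) := by
    rw [← map_pow]
    exact (h.value_monU (i + 1) (by omega) le_rfl hn).symm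
  have hUd : ν (U ^ d) = ν (algebraMap R K (P (i + 1) ^ (N * d))) := by
    rw [AddValuation.map_pow, hUν, ← AddValuation.map_pow, ← pow_mul, map_pow (algebraMap R K)]
  have hUd0 : U ^ d ≠ 0 := pow_ne_zero _ hU0
  -- the exponents of `P_{i+1}` in the correction terms are multiples of `N`
  have hq : ∀ k, ∃ q < d, σ k (i + 1) = q * N := by
    intro k
    have h1 := hval k
    rw [← lmon_natCast, value_lmon fun s hs => h.value_eq s (by omega), map_pow,
      AddValuation.map_pow, h.value_eq _ le_rfl, ← WithTop.coe_nsmul] at h1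
    have h2 := WithTop.coe_injective h1
    let e : ℕ → ℤ := fun s => if s = i + 1 then (N * d : ℕ) else 0
    have he : lval γ e (i + 2) = (N * d) • γ (i + 1) := by
      rw [lval_succ, lval, Finset.sum_eq_zero]
      · simp only [e, if_true, zero_add, natCast_zsmul]
      · intro s hs
        have := Finset.mem_range.1 hs
        simp only [e, if_neg (show s ≠ i + 1 by omega), zero_smul]
    have h3 : lval γ ((fun s => (σ k s : ℤ)) - e) (i + 2) = 0 := by
      rw [lval_sub, he, h2, sub_self]
    have h4 := h.dvd_of_lval_eq_zero h3
    simp only [Pi.sub_apply, e, if_true] at h4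
    have h5 : (N : ℤ) ∣ σ k (i + 1) := by
      have := dvd_add h4 (show (N : ℤ) ∣ ((N * d : ℕ) : ℤ) from ⟨d, by push_cast; ring⟩)
      simpa using this
    obtain ⟨q, hq⟩ := Int.natCast_dvd_natCast.1 h5
    refine ⟨q, ?_, by rw [hq, mul_comm]⟩
    have h6 := hred k (i + 1) (by omega) le_rfl
    rw [nn, ← ENat.natCast_toNat hn, ← ENat.natCast_toNat hd, ← hN, ← hd', hq] at h6
    exact Nat.lt_of_mul_lt_mul_left (a := N) (by exact_mod_cast h6)
  choose q hqd hq using hq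
  let B : Fin l → K := fun k =>
    algebraMap R K (c k * ∏ s ∈ Finset.range (i + 1), P s ^ σ k s) / U ^ (d - q k)
  have hterm : ∀ k, algebraMap R K (c k * ∏ s ∈ Finset.range (i + 1 + 1), P s ^ σ k s) / U ^ d =
      B k * z ^ q k := by
    intro k
    have e1 : U ^ d = U ^ (d - q k) * U ^ q k := by
      rw [← pow_add, Nat.sub_add_cancel (hqd k).le]
    rw [Finset.prod_range_succ, hzU, hq k, e1]
    simp only [B, map_mul, map_pow, div_pow]
    rw [pow_mul']
    field_simp
  have hBν : ∀ k, 0 ≤ ν (B k) := by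
    intro k
    have h1 : 0 ≤ ν (B k * z ^ q k) := by
      rw [← hterm k]
      refine value_div_nonneg hUd0 ?_
      rw [hUd, ← hval k, map_mul, AddValuation.map_mul]
      exact le_add_of_nonneg_left (Dominates.nonneg (ν := ν) _)
    rwa [AddValuation.map_mul, value_pow_eq_zero hzν, add_zero] at h1
  have hint : IsIntegral A α := isIntegral_of_toENat_relrank_ne_top alphaField_succ hd
  have hdeg : (minpoly A α).natDegree = d := by
    have := natDegree_minpoly_eq_toENat_relrank (alphaField_succ (ν := ν) (P := P) (w := w)) hint
    rw [hd', deg]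
    simp only [Nat.add_sub_cancel]
    rw [← this, ENat.toNat_natCast]
  have hzd : ν (z ^ d) = 0 := value_pow_eq_zero hzν d
  have hsplit : algebraMap R K (P (i + 2)) / U ^ d = z ^ d + ∑ k, B k * z ^ q k := by
    rw [hP, map_add, map_sum, add_div, Finset.sum_div, hzU, div_pow, ← pow_mul, map_pow, ← hzU]
    exact congrArg _ (Finset.sum_congr rfl fun k _ => hterm k)
  have hBz : ∀ k ∈ Finset.univ, 0 ≤ ν (B k * z ^ q k) := fun k _ => by
    rw [AddValuation.map_mul, value_pow_eq_zero hzν, add_zero]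
    exact hBν k
  rw [← hUd]
  refine lt_value_of_div_pos hUd0 ?_
  rw [hsplit]
  refine value_pos_of_valResidue_eq_zero
    (AddValuation.map_le_add ν hzd.ge (value_sum_nonneg _ hBz)) ?_
  rw [valResidue_add hzd.ge (value_sum_nonneg _ hBz), valResidue_sum _ hBz, valResidue_pow hzν.ge,
    ← alpha_eq, ← hα]
  have hroot := minpoly.aeval A α
  rw [Polynomial.aeval_eq_sum_range, hdeg, Finset.sum_range_succ, ← hdeg,
    (minpoly.monic hint).coeff_natDegree, one_smul, hdeg, add_comm] at hroot
  rw [← hroot]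
  congr 1
  have hfib : ∀ k ∈ (Finset.univ : Finset (Fin l)), q k ∈ Finset.range d := fun k _ =>
    Finset.mem_range.2 (hqd k)
  rw [← Finset.sum_fiberwise_of_maps_to hfib]
  refine Finset.sum_congr rfl fun t ht => ?_
  have hfil : (Finset.univ.filter fun k => σ k (i + 1) = t * N) =
      Finset.univ.filter fun k => q k = t := by
    ext k
    simp only [Finset.mem_filter, Finset.mem_univ, true_and]
    rw [hq k]
    exact Nat.mul_left_inj hNpos.ne'
  have h1 := hcoeff t (Finset.mem_range.1 ht)
  rw [Algebra.smul_def]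
  change _ = (((minpoly A α).coeff t : A) : ValResidueField ν) * _
  have h2 : (((minpoly A α).coeff t : A) : ValResidueField ν) =
      ∑ k with q k = t, valResidue ν (B k) := by
    refine h1.trans ?_
    rw [hfil, ← valResidue_sum _ fun k _ => hBν k]
    congr 1
    refine Finset.sum_congr rfl fun k hk => ?_
    rw [← (Finset.mem_filter.1 hk).2]
  rw [h2, Finset.sum_mul]
  refine Finset.sum_congr rfl fun k hk => ?_
  rw [valResidue_mul (hBν k) (value_pow_eq_zero hzν _).ge, valResidue_pow hzν.ge, ← alpha_eq,
    (Finset.mem_filter.1 hk).2]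

variable (ν P w) in
/-- The product `n_1 ⋯ n_{j-1}`, the order of `P_j` in `R / (x)` with respect to `y`. -/
def orderExp (j : ℕ) : ℕ :=
  ∏ s ∈ Finset.Ico 1 j, (nn ν P w s).toNat

variable (ν P w) in
/-- The properties of `P_0, …, P_i` produced by the algorithm that determine the values of
polynomials in them: besides the conditions of `HasValues`, the value of `P_{j+1}` is larger than
`n_j ν(P_j)`, and modulo `x = P_0` each `P_j` is a power of `y = P_1`. -/
structure IsGenSeq (γ : ℕ → Γ) (i : ℕ) : Prop extends HasValues ν P w γ i where
  nn_ne_top : ∀ j, 1 ≤ j → j < i → nn ν P w j ≠ ⊤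
  growth : ∀ j, 1 ≤ j → j < i → (nn ν P w j).toNat • γ j < γ (j + 1)
  sub_mem : ∀ j, 1 ≤ j → j ≤ i → P j - P 1 ^ orderExp ν P w j ∈ Ideal.span {P 0}

theorem nn_ne_zero : nn ν P w i ≠ 0 :=
  mul_ne_zero nbar_ne_zero deg_ne_zero

theorem IsGenSeq.mono (h : IsGenSeq ν P w γ i) {j : ℕ} (hj : j ≤ i) : IsGenSeq ν P w γ j where
  toHasValues := h.toHasValues.mono hj
  nn_ne_top s hs hs' := h.nn_ne_top s hs (by omega)
  growth s hs hs' := h.growth s hs (by omega)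
  sub_mem s hs hs' := h.sub_mem s hs (by omega)

theorem IsGenSeq.lt_succ (h : IsGenSeq ν P w γ i) {j : ℕ} (hj : 1 ≤ j) (hji : j < i) :
    γ j < γ (j + 1) := by
  refine lt_of_le_of_lt ?_ (h.growth j hj hji)
  have h1 : 1 ≤ (nn ν P w j).toNat := Nat.one_le_iff_ne_zero.2 fun e =>
    (ENat.toNat_eq_zero.1 e).elim nn_ne_zero (h.nn_ne_top j hj hji)
  simpa using nsmul_le_nsmul_left (h.pos j hji.le).le h1

theorem IsGenSeq.strictMono (h : IsGenSeq ν P w γ i) {j l : ℕ} (hj : 1 ≤ j) (hjl : j < l)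
    (hl : l ≤ i) : γ j < γ l := by
  induction l, hjl using Nat.le_induction with
  | base => exact h.lt_succ hj (by omega)
  | succ l hl' ih => exact (ih (by omega)).trans (h.lt_succ (by omega) (by omega))

/-- A reduced monomial in `P_1, …, P_i` has a smaller value than `P_{i+1}`. -/
theorem IsGenSeq.lval_lt (h : IsGenSeq ν P w γ (i + 1)) {σ : ℕ → ℕ} (h0 : σ 0 = 0)
    (hred : ∀ s, 1 ≤ s → s ≤ i → (σ s : ℕ∞) < nn ν P w s) :
    lval γ (fun s => (σ s : ℤ)) (i + 1) < γ (i + 1) := by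
  induction i with
  | zero => simpa [lval, h0] using h.pos 1 le_rfl
  | succ i ih =>
    have h1 := ih (h.mono (by omega)) fun s hs hs' => hred s hs (by omega)
    have h2 := hred (i + 1) (by omega) le_rfl
    rw [← ENat.natCast_toNat (h.nn_ne_top (i + 1) (by omega) (by omega)), Nat.cast_lt] at h2
    rw [lval_succ, natCast_zsmul]
    calc _ < γ (i + 1) + σ (i + 1) • γ (i + 1) := by gcongr
      _ = (σ (i + 1) + 1) • γ (i + 1) := by rw [succ_nsmul']
      _ ≤ (nn ν P w (i + 1)).toNat • γ (i + 1) :=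
        nsmul_le_nsmul_left (h.pos _ (by omega)).le h2
      _ < γ (i + 2) := h.growth (i + 1) (by omega) (by omega)

/-- Modulo `x`, one step of the algorithm raises to the power `n_i`: the correction terms are
divisible by `x`, as reduced monomials in `P_1, …, P_i` have smaller values. -/
theorem IsGenSeq.sub_mem_of_isStep (h : IsGenSeq ν P w γ (i + 1)) {CS : Set R}
    (hn : nn ν P w (i + 1) ≠ ⊤) (hs : IsStep ν CS P w (i + 1)) :
    P (i + 2) - P 1 ^ orderExp ν P w (i + 2) ∈ Ideal.span {P 0} := by
  obtain ⟨l, c, σ, -, hred, hval, hP, -⟩ := hs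
  have hdvd : ∀ k, ∏ s ∈ Finset.range (i + 1 + 1), P s ^ σ k s ∈ Ideal.span {P 0} := by
    intro k
    have h0 : σ k 0 ≠ 0 := by
      intro h0
      have h1 := h.lval_lt h0 fun s hs hs' => hred k s hs (by omega)
      have h2 := hval k
      rw [← lmon_natCast, value_lmon fun s hs => h.value_eq s (by omega), map_pow,
        AddValuation.map_pow, h.value_eq _ le_rfl, ← WithTop.coe_nsmul] at h2
      have h3 := WithTop.coe_injective h2
      have h4 := hred k (i + 1) (by omega) le_rfl
      rw [← ENat.natCast_toNat hn, Nat.cast_lt] at h4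
      have h5 := nsmul_le_nsmul_left (h.pos (i + 1) le_rfl).le h4
      rw [lval_succ, natCast_zsmul] at h3
      rw [← h3, succ_nsmul'] at h5
      exact absurd h5 (not_le.2 (by gcongr))
    refine Ideal.mem_of_dvd _ ?_ (Ideal.mem_span_singleton_self (P 0))
    exact (dvd_pow_self _ h0).trans
      (Finset.dvd_prod_of_mem (fun s => P s ^ σ k s) (Finset.mem_range.2 (by omega)))
  have h1 : orderExp ν P w (i + 2) = orderExp ν P w (i + 1) * (nn ν P w (i + 1)).toNat := by
    rw [orderExp, orderExp, Finset.prod_Ico_succ_top (by omega)]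
  rw [hP, h1, pow_mul, add_sub_right_comm]
  refine Ideal.add_mem _ ?_ (Ideal.sum_mem _ fun k _ => Ideal.mul_mem_left _ _ (hdvd k))
  exact Ideal.mem_of_dvd _ (sub_dvd_pow_sub_pow _ _ _) (h.sub_mem (i + 1) (by omega) le_rfl)

theorem IsAlgorithmOutput.isGenSeq [IsDomain R] [IsNoetherianRing R] [IsFractionRing R K]
    (hdim : ringKrullDim R = 2) {x y : R} (hxy : IsLocalRing.maximalIdeal R = Ideal.span {x, y})
    {CS : Set R} {Ω : ℕ∞} (hP : IsAlgorithmOutput ν CS x y Ω P w) (i : ℕ) (hi : 1 ≤ i)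
    (hiΩ : (i : ℕ∞) ≤ Ω) : IsGenSeq ν P w (genVal ν P) i := by
  obtain ⟨rfl, rfl⟩ : P 0 = x ∧ P 1 = y := ⟨hP.P_zero, hP.P_one⟩
  induction i, hi using Nat.le_induction with
  | base =>
    have hx0 : P 0 ≠ 0 := by
      intro h0
      have := pow_notMem_span_singleton hdim (hxy.trans (by rw [Set.pair_comm])) 1 (x := P 1)
      rw [h0] at this
      simp at this
    have hy0 : P 1 ≠ 0 := by
      intro h0
      have := pow_notMem_span_singleton hdim hxy 1
      rw [h0] at this
      simp at this
    have h1 : ∀ j ≤ 1, ν (algebraMap R K (P j)) = ((genVal ν P j : Γ) : WithTop Γ) := by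
      intro j hj
      apply genVal_spec
      rw [Ne, value_algebraMap_eq_top_iff]
      interval_cases j
      exacts [hx0, hy0]
    refine ⟨⟨h1, ?_, ?_⟩, ?_, ?_, ?_⟩
    · intro j hj
      have h2 : 0 < ν (algebraMap R K (P j)) := by
        rw [Dominates.pos_iff, hxy]
        apply Ideal.subset_span
        interval_cases j <;> simp
      rw [h1 j hj] at h2
      exact_mod_cast h2
    · exact fun j hj hj' ht => (hP.monU_spec j hj (le_trans (by exact_mod_cast hj') hiΩ) ht).2
    · intro j hj hj'
      omega
    · intro j hj hj'
      omega
    · intro j hj hj'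
      obtain rfl : j = 1 := by omega
      simp [orderExp]
  | succ i hi ih =>
    have hlt : (i : ℕ∞) < Ω := lt_of_lt_of_le (by exact_mod_cast i.lt_succ_self) hiΩ
    have h := ih hlt.le
    obtain ⟨i, rfl⟩ : ∃ l, i = l + 1 := ⟨i - 1, by omega⟩
    obtain ⟨hn, hd, hs⟩ := hP.step (i + 1) hi hlt
    have hnn : nn ν P w (i + 1) ≠ ⊤ := WithTop.mul_ne_top hn hd
    have h1 := h.value_lt_of_isStep hn hd hs
    have h2 := h.sub_mem_of_isStep hnn hs
    have h3 : P (i + 2) ≠ 0 := by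
      intro h0
      rw [h0, zero_sub, neg_mem_iff] at h2
      exact pow_notMem_span_singleton hdim hxy _ h2
    have h4 : ν (algebraMap R K (P (i + 2))) = ((genVal ν P (i + 2) : Γ) : WithTop Γ) := by
      apply genVal_spec
      rwa [Ne, value_algebraMap_eq_top_iff]
    rw [h4, map_pow, AddValuation.map_pow, h.value_eq _ le_rfl, ← WithTop.coe_nsmul,
      WithTop.coe_lt_coe] at h1
    refine ⟨⟨?_, ?_, ?_⟩, ?_, ?_, ?_⟩
    · intro j hj
      rcases hj.lt_or_eq with hj | rfl
      exacts [h.value_eq j (by omega), h4]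
    · intro j hj
      rcases hj.lt_or_eq with hj | rfl
      exacts [h.pos j (by omega), lt_of_le_of_lt (nsmul_nonneg (h.pos _ le_rfl).le _) h1]
    · exact fun j hj hj' ht => (hP.monU_spec j hj (le_trans (by exact_mod_cast hj') hiΩ) ht).2
    · intro j hj hj'
      rcases (Nat.lt_succ_iff.1 hj').lt_or_eq with hj' | rfl
      exacts [h.nn_ne_top j hj hj', hnn]
    · intro j hj hj'
      rcases (Nat.lt_succ_iff.1 hj').lt_or_eq with hj' | rfl
      exacts [h.growth j hj hj', h1]
    · intro j hj hj'
      rcases hj'.lt_or_eq with hj' | rfl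
      exacts [h.sub_mem j hj (by omega), h2]

end Step

/-! ### Approximation by reduced monomials -/

section Expansion

variable {R : Type*} [CommRing R] [IsLocalRing R] {x y : R} {CS : Set R}

theorem IsCoefficientSet.exists_sub_mem (hCS : IsCoefficientSet CS) (f : R) :
    ∃ c ∈ CS, f - c ∈ IsLocalRing.maximalIdeal R := by
  obtain ⟨c, hc, h⟩ := hCS.1.surjOn (Set.mem_univ (IsLocalRing.residue R f))
  exact ⟨c, hc, Ideal.Quotient.eq.1 h.symm⟩

theorem IsCoefficientSet.eq_zero (hCS : IsCoefficientSet CS) {c : R} (hc : c ∈ CS)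
    (h : IsLocalRing.residue R c = 0) : c = 0 :=
  hCS.1.injOn hc hCS.2.1 (h.trans (map_zero _).symm)

theorem exists_expansion_mod (hxy : IsLocalRing.maximalIdeal R = Ideal.span {x, y})
    (hCS : IsCoefficientSet CS) {M : ℕ → R} (hM : ∀ b, M b - y ^ b ∈ Ideal.span {x})
    (B : ℕ) (f : R) : ∃ c : ℕ → R, (∀ b, c b ∈ CS) ∧ ∃ g h : R,
      f = ∑ b ∈ Finset.range B, c b * M b + x * g + y ^ B * h := by
  induction B with
  | zero => exact ⟨fun _ => 0, fun _ => hCS.2.1, 0, f, by simp⟩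
  | succ B ih =>
    obtain ⟨c, hc, g, h, hf⟩ := ih
    obtain ⟨c', hc', hh⟩ := hCS.exists_sub_mem h
    rw [hxy, Ideal.mem_span_pair] at hh
    obtain ⟨u, v, huv⟩ := hh
    obtain ⟨m, hm⟩ := Ideal.mem_span_singleton'.1 (hM B)
    refine ⟨Function.update c B c', ?_, g + y ^ B * u - c' * m, v, ?_⟩
    · intro b
      by_cases hb : b = B
      · simpa [hb] using hc'
      · simpa [hb] using hc b
    · have h1 : ∑ b ∈ Finset.range B, Function.update c B c' b * M b =
          ∑ b ∈ Finset.range B, c b * M b :=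
        Finset.sum_congr rfl fun b hb => by
          rw [Function.update_of_ne (Finset.mem_range.1 hb).ne]
      rw [Finset.sum_range_succ, h1, Function.update_self, hf]
      linear_combination (-y ^ B) * huv + c' * hm

/-- Every element is a combination, with coefficients in the coefficient set, of the products
`x^a M_b`, up to multiples of high powers of `x` and `y`, if `M_b` is congruent to `y^b` modulo
`x`. -/
theorem exists_expansion (hxy : IsLocalRing.maximalIdeal R = Ideal.span {x, y})
    (hCS : IsCoefficientSet CS) {M : ℕ → R} (hM : ∀ b, M b - y ^ b ∈ Ideal.span {x})
    (A B : ℕ) (f : R) : ∃ c : ℕ → ℕ → R, (∀ a b, c a b ∈ CS) ∧ ∃ g h : R,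
      f = ∑ a ∈ Finset.range A, ∑ b ∈ Finset.range B, c a b * (x ^ a * M b) +
        x ^ A * g + y ^ B * h := by
  induction A with
  | zero => exact ⟨fun _ _ => 0, fun _ _ => hCS.2.1, f, 0, by simp⟩
  | succ A ih =>
    obtain ⟨c, hc, g, h, hf⟩ := ih
    obtain ⟨c', hc', g', h', hg⟩ := exists_expansion_mod hxy hCS hM B g
    refine ⟨Function.update c A c', ?_, g', h + x ^ A * h', ?_⟩
    · intro a
      by_cases ha : a = A
      · simpa [ha] using hc'
      · simpa [ha] using hc a
    · have h1 : ∑ a ∈ Finset.range A, ∑ b ∈ Finset.range B,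
          Function.update c A c' a b * (x ^ a * M b) =
          ∑ a ∈ Finset.range A, ∑ b ∈ Finset.range B, c a b * (x ^ a * M b) :=
        Finset.sum_congr rfl fun a ha => by
          rw [Function.update_of_ne (Finset.mem_range.1 ha).ne]
      have h2 : ∑ b ∈ Finset.range B, c' b * (x ^ A * M b) =
          x ^ A * ∑ b ∈ Finset.range B, c' b * M b := by
        rw [Finset.mul_sum]
        exact Finset.sum_congr rfl fun b _ => by ring
      rw [Finset.sum_range_succ, h1, Function.update_self, h2, hf]
      linear_combination x ^ A * hg

end Expansion

section Approximation

variable {R K Γ : Type*} [CommRing R] [IsLocalRing R] [Field K] [Algebra R K]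
  [AddCommGroup Γ] [LinearOrder Γ] [IsOrderedAddMonoid Γ]
  {ν : AddValuation K (WithTop Γ)} {P : ℕ → R} {w : ℕ → ℕ → ℕ} {γ : ℕ → Γ} {r : ℕ}
  [Dominates R ν]

/-- Mixed radix expansion: every natural number is `∑ τ_s n_1 ⋯ n_{s-1}` with digits `τ_s < n_s`,
except for the leading digit `τ_r`, which is arbitrary. -/
theorem exists_digits (hr : 1 ≤ r) (hn : ∀ j, 1 ≤ j → j < r → nn ν P w j ≠ ⊤) (b : ℕ) :
    ∃ τ : ℕ → ℕ, τ 0 = 0 ∧ (∀ s, 1 ≤ s → s < r → (τ s : ℕ∞) < nn ν P w s) ∧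
      ∑ s ∈ Finset.Ico 1 (r + 1), τ s * orderExp ν P w s = b := by
  induction r, hr using Nat.le_induction with
  | base =>
    refine ⟨fun s => if s = 0 then 0 else b, rfl, fun s hs hs' => by omega, ?_⟩
    simp [orderExp]
  | succ r hr ih =>
    obtain ⟨τ, h0, hτ, hb⟩ := ih fun j hj hj' => hn j hj (by omega)
    set n := (nn ν P w r).toNat with hnr
    have hne := hn r hr r.lt_succ_self
    have hpos : 0 < n := Nat.pos_of_ne_zero fun e =>
      (ENat.toNat_eq_zero.1 e).elim nn_ne_zero hne
    refine ⟨fun s => if s = r then τ r % n else if s = r + 1 then τ r / n else τ s, ?_, ?_, ?_⟩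
    · simp only [h0]
      rw [if_neg (by omega), if_neg (by omega)]
    · intro s hs hs'
      rcases (Nat.lt_succ_iff.1 hs').lt_or_eq with hs' | rfl
      · simp only [if_neg hs'.ne, if_neg (show s ≠ r + 1 by omega)]
        exact hτ s hs hs'
      · simp only [if_true]
        rw [← ENat.natCast_toNat hne, Nat.cast_lt]
        exact Nat.mod_lt _ hpos
    · have h1 : orderExp ν P w (r + 1) = orderExp ν P w r * n := by
        rw [orderExp, orderExp, Finset.prod_Ico_succ_top hr]
      rw [Finset.sum_Ico_succ_top (by omega)] at hb
      rw [Finset.sum_Ico_succ_top (by omega), Finset.sum_Ico_succ_top (by omega), h1]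
      beta_reduce
      rw [if_pos rfl, if_neg (by omega), if_pos rfl]
      have h2 : ∑ s ∈ Finset.Ico 1 r, (if s = r then τ r % n else
          if s = r + 1 then τ r / n else τ s) * orderExp ν P w s =
          ∑ s ∈ Finset.Ico 1 r, τ s * orderExp ν P w s :=
        Finset.sum_congr rfl fun s hs => by
          have := (Finset.mem_Ico.1 hs).2
          rw [if_neg (by omega), if_neg (by omega)]
      rw [h2, ← hb, add_assoc]
      congr 1
      conv_rhs => rw [← Nat.mod_add_div (τ r) n]
      ring

theorem IsGenSeq.prod_sub_mem (h : IsGenSeq ν P w γ r) {τ : ℕ → ℕ} (h0 : τ 0 = 0) :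
    ∏ s ∈ Finset.range (r + 1), P s ^ τ s -
      P 1 ^ (∑ s ∈ Finset.Ico 1 (r + 1), τ s * orderExp ν P w s) ∈ Ideal.span {P 0} := by
  rw [← Ideal.Quotient.eq, map_prod, map_pow, ← Finset.prod_pow_eq_pow_sum, Finset.range_eq_Ico,
    Finset.prod_eq_prod_Ico_succ_bot (by omega), h0, pow_zero, map_one, one_mul]
  refine Finset.prod_congr rfl fun s hs => ?_
  obtain ⟨hs, hs'⟩ := Finset.mem_Ico.1 hs
  rw [map_pow, Ideal.Quotient.eq.2 (h.sub_mem s hs (by omega)), map_pow, ← pow_mul, mul_comm]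

variable (ν P w) in
/-- The monomials of value `φ` in `P_0, …, P_r` which are reduced: the exponents of `P_s` are
smaller than `n_s` for `1 ≤ s ≤ r`. -/
def reducedMonomials (r : ℕ) (φ : Γ) : Set R :=
  {m | ∃ σ : ℕ → ℕ, (∀ s, 1 ≤ s → s ≤ r → (σ s : ℕ∞) < nn ν P w s) ∧
    m = ∏ s ∈ Finset.range (r + 1), P s ^ σ s ∧ ν (algebraMap R K m) = φ}

theorem IsGenSeq.value_prod (h : IsGenSeq ν P w γ r) (σ : ℕ → ℕ) :
    ν (algebraMap R K (∏ s ∈ Finset.range (r + 1), P s ^ σ s)) =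
      ((lval γ (fun s => (σ s : ℤ)) (r + 1) : Γ) : WithTop Γ) := by
  rw [← lmon_natCast, value_lmon fun s hs => h.value_eq s (by omega)]

theorem IsGenSeq.smul_le_lval (h : IsGenSeq ν P w γ r) (σ : ℕ → ℕ) {s : ℕ} (hs : s ≤ r) :
    σ s • γ s ≤ lval γ (fun s => (σ s : ℤ)) (r + 1) := by
  have := Finset.single_le_sum (f := fun s => (σ s : ℤ) • γ s) (s := Finset.range (r + 1))
    (fun s hs => zsmul_nonneg
      (h.pos s (Nat.lt_succ_iff.1 (Finset.mem_range.1 hs))).le (Int.natCast_nonneg _))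
    (Finset.mem_range.2 (Nat.lt_succ_iff.2 hs))
  simpa [lval] using this

/-- A sum of distinct reduced monomials of the same value `ψ` with nonzero coefficients from the
coefficient set has the value `ψ`. -/
theorem IsGenSeq.not_lt_value_sum (h : IsGenSeq ν P w γ r) {CS : Set R} (hCS : IsCoefficientSet CS)
    {ι : Type*} (S : Finset ι) (hS : S.Nonempty) (σ : ι → ℕ → ℕ) (c : ι → R) {ψ : Γ}
    (hc : ∀ k ∈ S, c k ∈ CS ∧ c k ≠ 0)
    (hred : ∀ k ∈ S, ∀ s, 1 ≤ s → s ≤ r → (σ k s : ℕ∞) < nn ν P w s)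
    (hval : ∀ k ∈ S, lval γ (fun s => (σ k s : ℤ)) (r + 1) = ψ)
    (hinj : ∀ k ∈ S, ∀ l ∈ S, (∀ s ≤ r, σ k s = σ l s) → k = l) :
    ¬ (ψ : WithTop Γ) <
      ν (algebraMap R K (∑ k ∈ S, c k * ∏ s ∈ Finset.range (r + 1), P s ^ σ k s)) := by
  intro hlt
  obtain ⟨k₀, hk₀⟩ := hS
  let e : ℕ → ℤ := fun s => σ k₀ s
  have hne : ∀ s < r + 1, algebraMap R K (P s) ≠ 0 := fun s hs => h.ne_zero (by omega)
  have hM0 : lmon K P e (r + 1) ≠ 0 := lmon_ne_zero hne e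
  have hMν : ν (lmon K P e (r + 1)) = ψ := by
    rw [value_lmon fun s hs => h.value_eq s (by omega), hval k₀ hk₀]
  have hz : ∀ k ∈ S, lval γ ((fun s => (σ k s : ℤ)) - e) (r + 1) = 0 := fun k hk => by
    rw [lval_sub, hval k hk, hval k₀ hk₀, sub_self]
  have hzν : ∀ k ∈ S, ν (lmon K P ((fun s => (σ k s : ℤ)) - e) (r + 1)) = 0 := fun k hk => by
    rw [value_lmon fun s hs => h.value_eq s (by omega), hz k hk, WithTop.coe_zero]
  have hall := h.toHasValues.coeff_eq_zero S σ (fun k => IsLocalRing.residue R (c k)) e hred hz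
    hinj ?_
  · exact (hc k₀ hk₀).2 (hCS.eq_zero (hc k₀ hk₀).1 (hall k₀ hk₀))
  · rw [← hMν] at hlt
    have h1 := valResidue_eq_zero (value_div_pos hM0 hlt)
    rw [← h1, map_sum, Finset.sum_div, valResidue_sum]
    · refine Finset.sum_congr rfl fun k hk => ?_
      rw [map_mul, mul_div_assoc, ← lmon_natCast, ← lmon_sub hne,
        valResidue_mul (Dominates.nonneg (ν := ν) _) (hzν k hk).ge, valResidue_algebraMap]
    · intro k hk
      rw [map_mul, mul_div_assoc, ← lmon_natCast, ← lmon_sub hne, AddValuation.map_mul, hzν k hk,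
        add_zero]
      exact Dominates.nonneg (ν := ν) _

/-- Modulo elements of larger value, an element of value `φ` is a combination of reduced monomials
of value `φ`, if `n_r = ∞` or `γ_r > φ`: monomials in `P_0, …, P_r` that are not reduced only
because of their exponent of `P_r` then do not exist or have values above `φ`. -/
theorem IsGenSeq.exists_approx (h : IsGenSeq ν P w γ r) (hr : 1 ≤ r)
    (hrank : Nonempty (AddValuation.toValuation ν).RankOne)
    (hxy : IsLocalRing.maximalIdeal R = Ideal.span {P 0, P 1})
    {CS : Set R} (hCS : IsCoefficientSet CS) {f : R} {φ : Γ}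
    (hf : ν (algebraMap R K f) = φ) (hlast : nn ν P w r = ⊤ ∨ φ < γ r) :
    ∃ g ∈ Submodule.span R (reducedMonomials ν P w r φ),
      (φ : WithTop Γ) < ν (algebraMap R K (f - g)) := by
  classical
  choose τ hτ0 hτn hτb using exists_digits (ν := ν) (P := P) (w := w) hr h.nn_ne_top
  have hlarge : ∀ j ≤ r, ∃ n : ℕ, (φ : WithTop Γ) < ν (algebraMap R K (P j) ^ n) := by
    intro j hj
    obtain ⟨n, hn⟩ := exists_nsmul_value_gt hrank (a := algebraMap R K (P j))
      (b := algebraMap R K f) (by rw [h.value_eq j hj]; exact_mod_cast h.pos j hj)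
      (by rw [hf]; exact WithTop.coe_ne_top)
    exact ⟨n, by rwa [AddValuation.map_pow, ← hf]⟩
  obtain ⟨A, hA⟩ := hlarge 0 (by omega)
  obtain ⟨B, hB⟩ := hlarge 1 hr
  let M : ℕ → R := fun b => ∏ s ∈ Finset.range (r + 1), P s ^ τ b s
  have hM : ∀ b, M b - P 1 ^ b ∈ Ideal.span {P 0} := by
    intro b
    have := h.prod_sub_mem (hτ0 b)
    rwa [hτb] at this
  obtain ⟨c, hc, g₁, h₁, hfexp⟩ := exists_expansion hxy hCS hM A B f
  let σ : ℕ × ℕ → ℕ → ℕ := fun k s => if s = 0 then k.1 else τ k.2 s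
  let m : ℕ × ℕ → R := fun k => ∏ s ∈ Finset.range (r + 1), P s ^ σ k s
  have hm : ∀ k, m k = P 0 ^ k.1 * M k.2 := by
    intro k
    simp only [m, M]
    rw [Finset.prod_range_succ', Finset.prod_range_succ']
    simp [σ, hτ0, mul_comm]
  have hσinj : ∀ k l, (∀ s ≤ r, σ k s = σ l s) → k = l := by
    intro k l hkl
    refine Prod.ext (by simpa [σ] using hkl 0 (by omega)) ?_
    rw [← hτb k.2, ← hτb l.2]
    refine Finset.sum_congr rfl fun s hs => ?_
    obtain ⟨hs, hs'⟩ := Finset.mem_Ico.1 hs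
    have := hkl s (by omega)
    simp only [σ, if_neg (show s ≠ 0 by omega)] at this
    rw [this]
  let v : ℕ × ℕ → Γ := fun k => lval γ (fun s => (σ k s : ℤ)) (r + 1)
  have hmv : ∀ k, ν (algebraMap R K (m k)) = v k := fun k => h.value_prod (σ k)
  have hred : ∀ k, v k ≤ φ → ∀ s, 1 ≤ s → s ≤ r → (σ k s : ℕ∞) < nn ν P w s := by
    intro k hk s hs hs'
    rcases hs'.lt_or_eq with hs' | rfl
    · simp only [σ, if_neg (show s ≠ 0 by omega)]
      exact hτn _ s hs hs'
    · rcases hlast with ht | hlt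
      · rw [ht]
        exact ENat.natCast_lt_top _
      · have h1 := (h.smul_le_lval (σ k) le_rfl).trans hk
        have h2 : σ k s = 0 := by
          by_contra h0
          have h3 : γ s ≤ σ k s • γ s := by
            simpa using nsmul_le_nsmul_left (h.pos s le_rfl).le (Nat.one_le_iff_ne_zero.2 h0)
          exact absurd (h3.trans h1) (not_le.2 hlt)
        rw [h2]
        exact pos_iff_ne_zero.2 nn_ne_zero
  let T : Finset (ℕ × ℕ) := Finset.range A ×ˢ Finset.range B
  let c' : ℕ × ℕ → R := fun k => c k.1 k.2
  let J : Finset (ℕ × ℕ) := T.filter fun k => c' k ≠ 0 ∧ v k ≤ φ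
  -- the terms outside `J` have values above `φ`
  have hrest : (φ : WithTop Γ) < ν (algebraMap R K (f - ∑ k ∈ J, c' k * m k)) := by
    have h1 : f - ∑ k ∈ J, c' k * m k = (∑ k ∈ T with ¬(c' k ≠ 0 ∧ v k ≤ φ), c' k * m k +
        P 0 ^ A * g₁) + P 1 ^ B * h₁ := by
      have h2 : ∑ a ∈ Finset.range A, ∑ b ∈ Finset.range B, c a b * (P 0 ^ a * M b) =
          ∑ k ∈ T, c' k * m k := by
        rw [Finset.sum_product]
        exact Finset.sum_congr rfl fun a _ => Finset.sum_congr rfl fun b _ => by rw [hm]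
      rw [hfexp, h2, ← Finset.sum_filter_add_sum_filter_not T fun k => c' k ≠ 0 ∧ v k ≤ φ]
      ring
    rw [h1]
    refine Ideal.add_mem (valIdealGT R ν φ) (Ideal.add_mem _ (Ideal.sum_mem _ fun k hk => ?_)
      (Ideal.mul_mem_right _ _ ?_)) (Ideal.mul_mem_right _ _ ?_)
    · have hk2 := (Finset.mem_filter.1 hk).2
      by_cases h0 : c' k = 0
      · rw [h0, zero_mul]
        exact Ideal.zero_mem _
      · refine Ideal.mul_mem_left _ _ ?_
        change (φ : WithTop Γ) < ν (algebraMap R K (m k))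
        rw [hmv, WithTop.coe_lt_coe]
        by_contra hle
        exact hk2 ⟨h0, not_lt.1 hle⟩
    · change (φ : WithTop Γ) < ν (algebraMap R K (P 0 ^ A))
      rwa [map_pow]
    · change (φ : WithTop Γ) < ν (algebraMap R K (P 1 ^ B))
      rwa [map_pow]
  refine ⟨∑ k ∈ J, c' k * m k, ?_, hrest⟩
  -- no cancellation among the terms of least value, so this least value is `φ`
  have hJφ : ∀ k ∈ J, v k = φ := by
    intro k hk
    obtain ⟨k₀, hk₀, hmin⟩ := Finset.exists_min_image J v ⟨k, hk⟩
    have hk₀' := (Finset.mem_filter.1 hk₀).2.2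
    by_contra hne
    have hψ : v k₀ < φ :=
      lt_of_le_of_lt (hmin k hk) (lt_of_le_of_ne (Finset.mem_filter.1 hk).2.2 hne)
    let S := J.filter fun k => v k = v k₀
    refine h.not_lt_value_sum hCS S ⟨k₀, Finset.mem_filter.2 ⟨hk₀, rfl⟩⟩ σ c' (ψ := v k₀)
      ?_ ?_ ?_ ?_ ?_
    · intro l hl
      exact ⟨hc _ _, (Finset.mem_filter.1 (Finset.mem_filter.1 hl).1).2.1⟩
    · intro l hl
      exact hred l (Finset.mem_filter.1 (Finset.mem_filter.1 hl).1).2.2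
    · exact fun l hl => (Finset.mem_filter.1 hl).2
    · exact fun l _ l' _ => hσinj l l'
    · have h1 : ∑ k ∈ S, c' k * m k =
          (f - (f - ∑ k ∈ J, c' k * m k)) - ∑ k ∈ J with ¬ v k = v k₀, c' k * m k := by
        rw [← Finset.sum_filter_add_sum_filter_not J fun k => v k = v k₀]
        ring
      change _ < ν (algebraMap R K (∑ k ∈ S, c' k * m k))
      rw [h1]
      have hψ' : (v k₀ : WithTop Γ) < φ := WithTop.coe_lt_coe.2 hψ
      refine Ideal.sub_mem (valIdealGT R ν (v k₀)) (Ideal.sub_mem _ ?_ (hψ'.trans hrest))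
        (Ideal.sum_mem _ fun l hl => Ideal.mul_mem_left _ _ ?_)
      · change (v k₀ : WithTop Γ) < ν (algebraMap R K f)
        rwa [hf]
      · obtain ⟨hl, hl'⟩ := Finset.mem_filter.1 hl
        change (v k₀ : WithTop Γ) < ν (algebraMap R K (m l))
        rw [hmv]
        exact WithTop.coe_lt_coe.2 (lt_of_le_of_ne (hmin l hl) (Ne.symm hl'))
  refine Submodule.sum_mem _ fun k hk => Submodule.smul_mem _ _ (Submodule.subset_span ?_)
  exact ⟨σ k, hred k (hJφ k hk).le, rfl, by rw [hmv, hJφ k hk]⟩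

theorem pow_maximalIdeal_le_valIdeal {g : Γ}
    (hg : ∀ f ∈ IsLocalRing.maximalIdeal R, (g : WithTop Γ) ≤ ν (algebraMap R K f)) (n : ℕ) :
    IsLocalRing.maximalIdeal R ^ n ≤ valIdeal R ν (n • g) := by
  induction n with
  | zero =>
    intro f _
    rw [zero_smul]
    exact mem_valIdeal_zero f
  | succ n ih =>
    rw [pow_succ, succ_nsmul, Ideal.mul_le]
    exact fun a ha b hb => mul_mem_valIdeal (ih ha) (hg b hb)

/-- Strictly increasing sequences of values of elements of `R` are unbounded: the valuation ideals
of the values below a bound contain a power of the maximal ideal, and `R` modulo such a power is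
Artinian. -/
theorem exists_lt_value [IsNoetherianRing R] (hrank : Nonempty (AddValuation.toValuation ν).RankOne)
    {x : R} (hx : IsLeast ((fun f : R => ν (algebraMap R K f)) ''
      (IsLocalRing.maximalIdeal R : Set R)) (ν (algebraMap R K x)))
    (hxtop : ν (algebraMap R K x) ≠ ⊤) {f : R} {φ : Γ} (hf : ν (algebraMap R K f) = φ)
    {Q : ℕ → R} {δ : ℕ → Γ} (hQ : ∀ j, ν (algebraMap R K (Q j)) = δ j)
    (hδ : ∀ j, δ j < δ (j + 1)) : ∃ j, φ < δ j := by
  by_contra! hle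
  obtain ⟨g, hg⟩ := WithTop.ne_top_iff_exists.1 hxtop
  have hmin : ∀ f ∈ IsLocalRing.maximalIdeal R, (g : WithTop Γ) ≤ ν (algebraMap R K f) :=
    fun f hf => hg ▸ hx.2 ⟨f, hf, rfl⟩
  have hxpos : 0 < ν (algebraMap R K x) := by
    obtain ⟨z, hz, hz'⟩ := hx.1
    rw [← hz']
    exact (Dominates.pos_iff (ν := ν) z).2 hz
  obtain ⟨n, hn⟩ := exists_nsmul_value_gt hrank (b := algebraMap R K f) hxpos
    (by rw [hf]; exact WithTop.coe_ne_top)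
  rw [hf, ← hg, ← WithTop.coe_nsmul, WithTop.coe_lt_coe] at hn
  set I := IsLocalRing.maximalIdeal R ^ (n + 1) with hI
  have hI1 : I ≠ ⊤ := fun e => (Ideal.IsPrime.ne_top inferInstance :
    IsLocalRing.maximalIdeal R ≠ ⊤) (top_le_iff.1 (e ▸ Ideal.pow_le_self n.succ_ne_zero))
  have hIle : ∀ j, I ≤ valIdeal R ν (δ j) := by
    intro j z hz
    have h1 : z ∈ valIdeal R ν (n • g) :=
      pow_maximalIdeal_le_valIdeal hmin n (Ideal.pow_le_pow_right n.le_succ hz)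
    exact le_trans (WithTop.coe_le_coe.2 ((hle j).trans hn.le)) h1
  have : Nontrivial (R ⧸ I) := Ideal.Quotient.nontrivial_iff.2 hI1
  have : IsLocalRing (R ⧸ I) := IsLocalRing.of_surjective' _ Ideal.Quotient.mk_surjective
  have hart : IsArtinianRing (R ⧸ I) := by
    rw [isArtinianRing_iff_isNilpotent_maximalIdeal]
    refine ⟨n + 1, ?_⟩
    rw [← IsLocalRing.map_maximalIdeal_of_surjective _ Ideal.Quotient.mk_surjective,
      ← Ideal.map_pow, ← hI, Ideal.map_quotient_self]
    rfl
  have hanti : Antitone fun j => (valIdeal R ν (δ j)).map (Ideal.Quotient.mk I) := by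
    refine antitone_nat_of_succ_le fun j => Ideal.map_mono fun z hz => ?_
    exact le_trans (WithTop.coe_le_coe.2 (hδ j).le) hz
  obtain ⟨N, hN⟩ := IsArtinian.monotone_stabilizes
    (⟨fun j => OrderDual.toDual ((valIdeal R ν (δ j)).map (Ideal.Quotient.mk I)), hanti⟩ :
      ℕ →o (Submodule (R ⧸ I) (R ⧸ I))ᵒᵈ)
  have h1 : (valIdeal R ν (δ N)).map (Ideal.Quotient.mk I) =
    (valIdeal R ν (δ (N + 1))).map (Ideal.Quotient.mk I) := hN (N + 1) N.le_succ
  have h2 := congrArg (Ideal.comap (Ideal.Quotient.mk I)) h1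
  rw [Ideal.comap_map_of_surjective' _ Ideal.Quotient.mk_surjective,
    Ideal.comap_map_of_surjective' _ Ideal.Quotient.mk_surjective, Ideal.mk_ker,
    sup_eq_left.2 (hIle N), sup_eq_left.2 (hIle (N + 1))] at h2
  have h3 : Q N ∈ valIdeal R ν (δ N) := (hQ N).ge
  rw [h2] at h3
  have h4 : ((δ (N + 1) : Γ) : WithTop Γ) ≤ ν (algebraMap R K (Q N)) := h3
  rw [hQ, WithTop.coe_le_coe] at h4
  exact absurd h4 (not_le.2 (hδ N))

end Approximation

/-! ### Residues of quotients of elements of equal value -/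

section Monomials

variable {R K Γ : Type*} [CommRing R] [Field K] [Algebra R K]
  [AddCommGroup Γ] [LinearOrder Γ] [IsOrderedAddMonoid Γ]
  {ν : AddValuation K (WithTop Γ)} {P : ℕ → R} {r : ℕ} {φ : Γ}

/-- If `f` of value `φ` is approximated by elements of the span of a set `X`, then `X` is nonempty.
-/
theorem nonempty_of_lt_value_sub {X : Set R} {f g : R} (hf : ν (algebraMap R K f) = φ)
    (hg : g ∈ Submodule.span R X) (h : (φ : WithTop Γ) < ν (algebraMap R K (f - g))) :
    X.Nonempty := by
  by_contra hne
  rw [Set.not_nonempty_iff_eq_empty] at hne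
  rw [hne, Submodule.span_empty, Submodule.mem_bot] at hg
  rw [hg, sub_zero, hf] at h
  exact h.false

variable (ν P) in
/-- The ideal of `R` generated by the monomials of value `φ` in `P_0, …, P_r`. -/
def monomialSpan (r : ℕ) (φ : Γ) : Submodule R R :=
  Submodule.span R {m | ∃ σ : ℕ → ℕ, m = ∏ s ∈ Finset.range (r + 1), P s ^ σ s ∧
    ν (algebraMap R K m) = φ}

theorem monomialSpan_mono {r' : ℕ} (hr : r ≤ r') :
    monomialSpan ν P r φ ≤ monomialSpan ν P r' φ := by
  refine Submodule.span_mono ?_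
  rintro m ⟨σ, rfl, hm⟩
  refine ⟨fun s => if s ≤ r then σ s else 0, ?_, hm⟩
  refine Finset.prod_subset_one_on_sdiff (Finset.range_mono (by omega)) ?_ ?_
  · intro s hs
    have h1 := (Finset.mem_sdiff.1 hs).2
    rw [Finset.mem_range] at h1
    beta_reduce
    rw [if_neg (by omega), pow_zero]
  · intro s hs
    beta_reduce
    rw [if_pos (Nat.lt_succ_iff.1 (Finset.mem_range.1 hs))]

end Monomials

section Span

variable {R K Γ : Type*} [CommRing R] [IsLocalRing R] [Field K] [Algebra R K]
  [AddCommGroup Γ] [LinearOrder Γ] [IsOrderedAddMonoid Γ]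
  {ν : AddValuation K (WithTop Γ)} {P : ℕ → R} {w : ℕ → ℕ → ℕ} {γ : ℕ → Γ} {r : ℕ} {φ : Γ}
  [Dominates R ν]

theorem span_reducedMonomials_le :
    Submodule.span R (reducedMonomials ν P w r φ) ≤ monomialSpan ν P r φ :=
  Submodule.span_mono fun _ ⟨σ, _, hm, hν⟩ => ⟨σ, hm, hν⟩

theorem HasValues.valResidue_div_mem_of_mem_span (h : HasValues ν P w γ r) {e : ℕ → ℤ}
    (he : lval γ e (r + 1) = φ) {g : R} (hg : g ∈ monomialSpan ν P r φ) :
    0 ≤ ν (algebraMap R K g / lmon K P e (r + 1)) ∧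
      valResidue ν (algebraMap R K g / lmon K P e (r + 1)) ∈ alphaField ν P w r := by
  have hne : ∀ s < r + 1, algebraMap R K (P s) ≠ 0 := fun s hs => h.ne_zero (by omega)
  induction hg using Submodule.span_induction with
  | mem m hm =>
    obtain ⟨σ, rfl, hm⟩ := hm
    rw [← lmon_natCast] at hm ⊢
    rw [value_lmon fun s hs => h.value_eq s (by omega), WithTop.coe_inj] at hm
    have h0 : lval γ ((fun s => (σ s : ℤ)) - e) (r + 1) = 0 := by
      rw [lval_sub, hm, he, sub_self]
    rw [← lmon_sub hne]
    refine ⟨?_, h.valResidue_lmon_mem h0⟩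
    rw [value_lmon fun s hs => h.value_eq s (by omega), h0, WithTop.coe_zero]
  | zero => simp
  | add a b _ _ ha hb =>
    rw [map_add, add_div]
    refine ⟨AddValuation.map_le_add ν ha.1 hb.1, ?_⟩
    rw [valResidue_add ha.1 hb.1]
    exact add_mem ha.2 hb.2
  | smul c a _ ha =>
    have hc : 0 ≤ ν (algebraMap R K c) := Dominates.nonneg (ν := ν) c
    rw [smul_eq_mul, map_mul, mul_div_assoc]
    refine ⟨?_, ?_⟩
    · rw [AddValuation.map_mul]
      exact add_nonneg hc ha.1
    · rw [valResidue_mul hc ha.1, valResidue_algebraMap]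
      exact mul_mem (IntermediateField.algebraMap_mem _ _) ha.2

theorem HasValues.valResidue_div_mem (h : HasValues ν P w γ r) {e : ℕ → ℤ}
    (he : lval γ e (r + 1) = φ) {f g : R} (hg : g ∈ monomialSpan ν P r φ)
    (hfg : (φ : WithTop Γ) < ν (algebraMap R K (f - g))) :
    valResidue ν (algebraMap R K f / lmon K P e (r + 1)) ∈ alphaField ν P w r := by
  have hM0 : lmon K P e (r + 1) ≠ 0 := lmon_ne_zero (fun s hs => h.ne_zero (by omega)) _
  have hMν : ν (lmon K P e (r + 1)) = φ := by
    rw [value_lmon fun s hs => h.value_eq s (by omega), he]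
  obtain ⟨h1, h2⟩ := h.valResidue_div_mem_of_mem_span he hg
  have h3 : 0 < ν (algebraMap R K (f - g) / lmon K P e (r + 1)) :=
    value_div_pos hM0 (by rwa [hMν])
  have h4 : algebraMap R K f / lmon K P e (r + 1) =
      algebraMap R K (f - g) / lmon K P e (r + 1) + algebraMap R K g / lmon K P e (r + 1) := by
    rw [← add_div, ← map_add, sub_add_cancel]
  rw [h4, valResidue_add h3.le h1, valResidue_eq_zero h3, zero_add]
  exact h2

variable (ν P w) in
/-- The conclusion drawn from running the algorithm to its end: up to larger values, every nonzero
element of `R` is a combination of reduced monomials of its own value. -/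
def HasApproximation (Ω : ℕ∞) : Prop :=
  ∀ (f : R) (φ : Γ), ν (algebraMap R K f) = φ → ∃ r : ℕ, 1 ≤ r ∧ (r : ℕ∞) ≤ Ω ∧
    ∃ g ∈ Submodule.span R (reducedMonomials ν P w r φ),
      (φ : WithTop Γ) < ν (algebraMap R K (f - g))

theorem IsAlgorithmOutput.hasApproximation [IsNoetherianRing R]
    (hrank : Nonempty (AddValuation.toValuation ν).RankOne)
    {x y : R} (hxy : IsLocalRing.maximalIdeal R = Ideal.span {x, y})
    (hx : IsLeast ((fun f : R => ν (algebraMap R K f)) '' (IsLocalRing.maximalIdeal R : Set R))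
      (ν (algebraMap R K x)))
    {CS : Set R} (hCS : IsCoefficientSet CS) {Ω : ℕ∞} (hP : IsAlgorithmOutput ν CS x y Ω P w)
    (hgen : ∀ i : ℕ, 1 ≤ i → (i : ℕ∞) ≤ Ω → IsGenSeq ν P w γ i) :
    HasApproximation ν P w Ω := by
  intro f φ hf
  obtain ⟨rfl, rfl⟩ : P 0 = x ∧ P 1 = y := ⟨hP.P_zero, hP.P_one⟩
  suffices h : ∃ r : ℕ, 1 ≤ r ∧ (r : ℕ∞) ≤ Ω ∧ (nn ν P w r = ⊤ ∨ φ < γ r) by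
    obtain ⟨r, hr, hrΩ, h⟩ := h
    exact ⟨r, hr, hrΩ, (hgen r hr hrΩ).exists_approx hr hrank hxy hCS hf h⟩
  by_cases hΩ : Ω = ⊤
  · subst hΩ
    have hγ : ∀ j, 1 ≤ j → IsGenSeq ν P w γ j := fun j hj => hgen j hj le_top
    obtain ⟨j, hj⟩ := exists_lt_value hrank hx
      (by rw [(hγ 1 le_rfl).value_eq 0 (by omega)]; exact WithTop.coe_ne_top) hf
      (Q := fun j => P (j + 1)) (δ := fun j => γ (j + 1))
      (fun j => (hγ (j + 1) (by omega)).value_eq _ le_rfl)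
      fun j => (hγ (j + 2) (by omega)).lt_succ (by omega) (by omega)
    exact ⟨j + 1, by omega, le_top, Or.inr hj⟩
  · obtain ⟨m, rfl⟩ := ENat.ne_top_iff_exists.1 hΩ
    refine ⟨m, by exact_mod_cast hP.one_le, le_rfl, Or.inl ?_⟩
    rcases hP.terminates m rfl with h | h
    · rw [nn, h, ENat.top_mul deg_ne_zero]
    · rw [nn, h, ENat.mul_top nbar_ne_zero]

end Span

/-! ### The value semigroup -/

section Semigroup

theorem minimal_closure_eq {A : Type*} [AddMonoid A] {S : Set A} {M : AddSubmonoid A}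
    (hS : AddSubmonoid.closure S = M) (h : ∀ a ∈ S, a ∉ AddSubmonoid.closure (S \ {a})) :
    Minimal (fun T : Set A => AddSubmonoid.closure T = M) S := by
  refine ⟨hS, fun T hT hTS a ha => ?_⟩
  by_contra haT
  refine h a ha ?_
  have h1 : a ∈ AddSubmonoid.closure T := by
    rw [hT, ← hS]
    exact AddSubmonoid.subset_closure ha
  exact AddSubmonoid.closure_mono (Set.subset_sdiff_singleton hTS haT) h1

variable {R K Γ : Type*} [CommRing R] [IsLocalRing R] [Field K] [Algebra R K]
  [AddCommGroup Γ] [LinearOrder Γ] [IsOrderedAddMonoid Γ]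
  {ν : AddValuation K (WithTop Γ)} {P : ℕ → R} {w : ℕ → ℕ → ℕ} {γ : ℕ → Γ} {Ω : ℕ∞}
  [Dominates R ν]

theorem IsGenSeq.eq_of_value_eq {i j : ℕ} (h : IsGenSeq ν P w γ i) (hj : j ≤ i) {g : Γ}
    (hg : ν (algebraMap R K (P j)) = g) : g = γ j :=
  WithTop.coe_injective (hg.symm.trans (h.value_eq j hj))

variable (ν P Ω) in
/-- The values of `P_0` and of the `P_i` with `n̄_i > 1`, `1 ≤ i ≤ Ω`. -/
def valueGenerators : Set Γ :=
  {g | ν (algebraMap R K (P 0)) = (g : WithTop Γ)} ∪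
    {g | ∃ i : ℕ, 1 ≤ i ∧ (i : ℕ∞) ≤ Ω ∧ 1 < nbar ν P i ∧
      ν (algebraMap R K (P i)) = (g : WithTop Γ)}

theorem closure_values_eq (h1Ω : 1 ≤ Ω)
    (hgen : ∀ i : ℕ, 1 ≤ i → (i : ℕ∞) ≤ Ω → IsGenSeq ν P w γ i)
    (happ : HasApproximation ν P w Ω) :
    AddSubmonoid.closure (valueGenerators ν P Ω) = valueSemigroup R ν := by
  set S := valueGenerators ν P Ω
  apply le_antisymm
  · rw [AddSubmonoid.closure_le]
    rintro g (hg | ⟨i, -, -, -, hg⟩)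
    exacts [⟨P 0, hg⟩, ⟨P i, hg⟩]
  · have hmem : ∀ i : ℕ, (i : ℕ∞) ≤ Ω → γ i ∈ AddSubmonoid.closure S := by
      intro i
      induction i using Nat.strong_induction_on with
      | _ i ih =>
        intro hi
        rcases Nat.eq_zero_or_pos i with rfl | hpos
        · exact AddSubmonoid.subset_closure
            (Or.inl ((hgen 1 le_rfl (by exact_mod_cast h1Ω)).value_eq 0 (by omega)))
        · have h := hgen i hpos hi
          obtain ⟨i, rfl⟩ : ∃ l, i = l + 1 := ⟨i - 1, by omega⟩
          by_cases hn : 1 < nbar ν P (i + 1)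
          · exact AddSubmonoid.subset_closure (Or.inr ⟨i + 1, hpos, hi, hn, h.value_eq _ le_rfl⟩)
          · have hn1 : nbar ν P (i + 1) = 1 :=
              le_antisymm (not_lt.1 hn) (Order.one_le_iff_ne_zero.2 nbar_ne_zero)
            have hU := h.lval_uexp
            rw [hn1, ENat.toNat_one, Nat.cast_one, one_smul, uexp,
              if_neg (by rw [hn1]; exact ENat.one_ne_top)] at hU
            rw [← hU, lval]
            refine sum_mem fun s hs => ?_
            have hs' := Finset.mem_range.1 hs
            rw [natCast_zsmul]
            exact nsmul_mem (ih s hs' (le_trans (by exact_mod_cast hs'.le) hi)) _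
    rintro g ⟨f, hf⟩
    obtain ⟨r, hr, hrΩ, a, ha, hfa⟩ := happ f g hf
    obtain ⟨m, σ, -, rfl, hm⟩ := nonempty_of_lt_value_sub hf ha hfa
    rw [(hgen r hr hrΩ).value_prod, WithTop.coe_inj] at hm
    rw [← hm, lval]
    refine sum_mem fun s hs => ?_
    have hs' := Nat.lt_succ_iff.1 (Finset.mem_range.1 hs)
    rw [natCast_zsmul]
    exact nsmul_mem (hmem s (le_trans (by exact_mod_cast hs') hrΩ)) _

/-- The values of the `P_i` with `n̄_i > 1` and of `x` minimally generate the value semigroup: a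
relation expressing `ν(P_i)` involves smaller values only, so that it would put `ν(P_i)` into
`G(ν(P_0), …, ν(P_{i-1}))`. -/
theorem minimal_values (h1Ω : 1 ≤ Ω)
    (hgen : ∀ i : ℕ, 1 ≤ i → (i : ℕ∞) ≤ Ω → IsGenSeq ν P w γ i)
    (happ : HasApproximation ν P w Ω) (hmin : γ 0 ≤ γ 1) :
    Minimal (fun T : Set Γ => AddSubmonoid.closure T = valueSemigroup R ν)
      (valueGenerators ν P Ω) := by
  have h1 := hgen 1 le_rfl (by exact_mod_cast h1Ω)
  refine minimal_closure_eq (closure_values_eq h1Ω hgen happ) ?_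
  rintro a (ha | ⟨i, hi, hiΩ, hn, ha⟩) hmem
  · obtain rfl := h1.eq_of_value_eq (by omega) ha
    have key : ∀ z ∈ AddSubmonoid.closure (valueGenerators ν P Ω \ {γ 0}), z = 0 ∨ γ 0 < z := by
      intro z hz
      induction hz using AddSubmonoid.closure_induction with
      | mem z hz =>
        obtain ⟨hz | ⟨j, hj, hjΩ, -, hz⟩, hne⟩ := hz
        · exact absurd (h1.eq_of_value_eq (by omega) hz) hne
        · have hgj := hgen j hj hjΩ
          obtain rfl := hgj.eq_of_value_eq le_rfl hz
          right
          refine lt_of_le_of_ne ?_ (Ne.symm hne)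
          rcases hj.lt_or_eq with hj | rfl
          exacts [hmin.trans (hgj.strictMono le_rfl hj le_rfl).le, hmin]
      | zero => exact Or.inl rfl
      | add a b _ _ ha hb =>
        rcases ha with rfl | ha
        · rwa [zero_add]
        · rcases hb with rfl | hb
          · rw [add_zero]
            exact Or.inr ha
          · exact Or.inr (ha.trans (lt_add_of_pos_right a ((h1.pos 0 (by omega)).trans hb)))
    rcases key _ hmem with h0 | h0
    exacts [(h1.pos 0 (by omega)).ne' h0, h0.false]
  · have hgi := hgen i hi hiΩ
    obtain rfl := hgi.eq_of_value_eq le_rfl ha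
    obtain ⟨i, rfl⟩ : ∃ l, i = l + 1 := ⟨i - 1, by omega⟩
    have key : ∀ z ∈ AddSubmonoid.closure (valueGenerators ν P Ω \ {γ (i + 1)}),
        0 ≤ z ∧ (z ≤ γ (i + 1) → z ∈ valGroup ν P i) := by
      intro z hz
      induction hz using AddSubmonoid.closure_induction with
      | mem z hz =>
        obtain ⟨hz | ⟨j, hj, hjΩ, -, hz⟩, hne⟩ := hz
        · obtain rfl := h1.eq_of_value_eq (by omega) hz
          exact ⟨(h1.pos 0 (by omega)).le, fun _ => mem_valGroup (by omega) hz⟩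
        · have hgj := hgen j hj hjΩ
          obtain rfl := hgj.eq_of_value_eq le_rfl hz
          refine ⟨(hgj.pos j le_rfl).le, fun hle => mem_valGroup ?_ hz⟩
          by_contra hji
          rcases (show i + 1 ≤ j by omega).lt_or_eq with hlt | rfl
          exacts [absurd hle (not_le.2 (hgj.strictMono hi hlt le_rfl)), hne rfl]
      | zero => exact ⟨le_rfl, fun _ => zero_mem _⟩
      | add a b _ _ ha hb =>
        refine ⟨add_nonneg ha.1 hb.1, fun hle => add_mem (ha.2 ?_) (hb.2 ?_)⟩
        exacts [(le_add_of_nonneg_right hb.1).trans hle, (le_add_of_nonneg_left ha.1).trans hle]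
    rw [nbar_succ_eq_one ha ((key _ hmem).2 le_rfl)] at hn
    exact hn.false

end Semigroup

/-! ### The residue field -/

section ResidueField

variable {R K Γ : Type*} [CommRing R] [IsLocalRing R] [Field K] [Algebra R K]
  [AddCommGroup Γ] [LinearOrder Γ] [IsOrderedAddMonoid Γ]
  {ν : AddValuation K (WithTop Γ)} {P : ℕ → R} {w : ℕ → ℕ → ℕ} {γ : ℕ → Γ} {Ω : ℕ∞}
  [Dominates R ν]

theorem alphaField_le_adjoin (i : ℕ) (hi : (i : ℕ∞) ≤ Ω) :
    alphaField ν P w i ≤ IntermediateField.adjoin (IsLocalRing.ResidueField R)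
      {a : ValResidueField ν | ∃ i : ℕ, 1 ≤ i ∧ (i : ℕ∞) ≤ Ω ∧ 1 < deg ν P w i ∧
        a = alpha ν P w i} := by
  induction i with
  | zero =>
    refine IntermediateField.adjoin_le_iff.2 ?_
    rintro a ⟨j, hj, hj', -⟩
    omega
  | succ i ih =>
    have hle := ih (le_trans (by exact_mod_cast i.le_succ) hi)
    rw [alphaField_succ, sup_le_iff, IntermediateField.adjoin_simple_le_iff]
    refine ⟨hle, ?_⟩
    by_cases hd : 1 < deg ν P w (i + 1)
    · exact IntermediateField.subset_adjoin _ _ ⟨i + 1, by omega, hi, hd, rfl⟩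
    · have hd1 : deg ν P w (i + 1) = 1 :=
        le_antisymm (not_lt.1 hd) (Order.one_le_iff_ne_zero.2 deg_ne_zero)
      exact hle (deg_succ_eq_one_iff.1 hd1)

/-- An element of value zero is a quotient `f / g` with `f, g ∈ R` of the same value; the residues
of `f` and `g` divided by a monomial of that value lie in some `k(α_1, …, α_r)`. -/
theorem adjoin_alpha_eq_top [IsFractionRing R K]
    (hgen : ∀ i : ℕ, 1 ≤ i → (i : ℕ∞) ≤ Ω → IsGenSeq ν P w γ i)
    (happ : HasApproximation ν P w Ω) :
    IntermediateField.adjoin (IsLocalRing.ResidueField R)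
      {a : ValResidueField ν | ∃ i : ℕ, 1 ≤ i ∧ (i : ℕ∞) ≤ Ω ∧ 1 < deg ν P w i ∧
        a = alpha ν P w i} = ⊤ := by
  rw [eq_top_iff]
  rintro z -
  obtain ⟨⟨u, hu⟩, rfl⟩ := IsLocalRing.residue_surjective z
  have hu0 : 0 ≤ ν u := mem_valRing.1 hu
  rw [← valResidue_of_nonneg hu0]
  rcases hu0.lt_or_eq with hpos | hzero
  · rw [valResidue_eq_zero hpos]
    exact zero_mem _
  obtain ⟨f, g, hg, rfl⟩ := IsFractionRing.div_surjective (A := R) u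
  have hg0 : algebraMap R K g ≠ 0 := fun e => by
    rw [e, div_zero] at hzero
    simp at hzero
  have hfg : ν (algebraMap R K f) = ν (algebraMap R K g) := by
    conv_lhs => rw [← div_mul_cancel₀ (algebraMap R K f) hg0, AddValuation.map_mul, ← hzero,
      zero_add]
  obtain ⟨φ, hφ⟩ := WithTop.ne_top_iff_exists.1
    (fun e => hg0 ((AddValuation.top_iff ν).1 e) : ν (algebraMap R K g) ≠ ⊤)
  obtain ⟨r₁, hr₁, hr₁Ω, a, ha, hfa⟩ := happ f φ (hfg.trans hφ.symm)
  obtain ⟨r₂, hr₂, hr₂Ω, b, hb, hgb⟩ := happ g φ hφ.symm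
  obtain ⟨r, hr, hrΩ, h₁, h₂⟩ : ∃ r : ℕ, 1 ≤ r ∧ (r : ℕ∞) ≤ Ω ∧ r₁ ≤ r ∧ r₂ ≤ r := by
    rcases le_total r₁ r₂ with h | h
    exacts [⟨r₂, hr₂, hr₂Ω, h, le_rfl⟩, ⟨r₁, hr₁, hr₁Ω, le_rfl, h⟩]
  have h := (hgen r hr hrΩ).toHasValues
  have ha' := monomialSpan_mono h₁ (span_reducedMonomials_le ha)
  have hb' := monomialSpan_mono h₂ (span_reducedMonomials_le hb)
  obtain ⟨m, σ, rfl, hm⟩ := nonempty_of_lt_value_sub hφ.symm hb' hgb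
  rw [(hgen r hr hrΩ).value_prod, WithTop.coe_inj] at hm
  set M := lmon K P (fun s => (σ s : ℤ)) (r + 1) with hM
  have hM0 : M ≠ 0 := lmon_ne_zero (fun s hs => h.ne_zero (by omega)) _
  have hMν : ν M = φ := by rw [hM, value_lmon fun s hs => h.value_eq s (by omega), hm]
  have hfM : ν (algebraMap R K f / M) = 0 := value_div_eq_zero hM0 (by rw [hMν, hfg, hφ])
  have hgM : ν (algebraMap R K g / M) = 0 := value_div_eq_zero hM0 (by rw [hMν, hφ])
  have hquot : algebraMap R K f / algebraMap R K g =
      (algebraMap R K f / M) * (algebraMap R K g / M)⁻¹ := by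
    field_simp
  rw [hquot, valResidue_mul hfM.ge (value_inv_eq_zero hgM).ge, valResidue_inv hgM]
  exact alphaField_le_adjoin r hrΩ (mul_mem (h.valResidue_div_mem hm ha' hfa)
    (inv_mem (h.valResidue_div_mem hm hb' hgb)))

end ResidueField

/-! ### Generators of the associated graded ring -/

section InitialForms

variable {R K Γ : Type*} [CommRing R] [IsLocalRing R] [Field K] [Algebra R K]
  [AddCommGroup Γ] [LinearOrder Γ] [IsOrderedAddMonoid Γ]
  {ν : AddValuation K (WithTop Γ)} [Dominates R ν]

theorem initialForm_eq_of {f : R} {φ : Γ} (h : ν (algebraMap R K f) = φ) :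
    initialForm R ν f = DirectSum.of (GrPiece R ν) φ (GrPiece.mk R ν φ ⟨f, h.ge⟩) := by
  have htop : ν (algebraMap R K f) ≠ ⊤ := by rw [h]; exact WithTop.coe_ne_top
  rw [initialForm, dif_neg htop]
  refine DirectSum.of_eq_of_gradedMonoid_eq (GrPiece.sigma_ext ?_ rfl)
  exact WithTop.coe_injective ((WithTop.coe_untop _ htop).trans h)

theorem initialForm_one : initialForm R ν 1 = 1 :=
  initialForm_eq_of (φ := 0) (by simp)

theorem initialForm_mul {f g : R} {φ ψ : Γ} (hf : ν (algebraMap R K f) = φ)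
    (hg : ν (algebraMap R K g) = ψ) :
    initialForm R ν (f * g) = initialForm R ν f * initialForm R ν g := by
  have h : ν (algebraMap R K (f * g)) = ((φ + ψ : Γ) : WithTop Γ) := by
    rw [map_mul, AddValuation.map_mul, hf, hg, WithTop.coe_add]
  rw [initialForm_eq_of hf, initialForm_eq_of hg, initialForm_eq_of h, DirectSum.of_mul_of]
  rfl

theorem initialForm_pow {f : R} {φ : Γ} (hf : ν (algebraMap R K f) = φ) (n : ℕ) :
    initialForm R ν (f ^ n) = initialForm R ν f ^ n := by
  induction n with
  | zero => rw [pow_zero, pow_zero, initialForm_one]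
  | succ n ih =>
    rw [pow_succ, pow_succ, ← ih, initialForm_mul (φ := n • φ) _ hf]
    rw [map_pow, AddValuation.map_pow, hf, WithTop.coe_nsmul]

theorem of_mk_eq_zero {f : R} {φ : Γ} (hf : f ∈ valIdeal R ν φ)
    (h : (φ : WithTop Γ) < ν (algebraMap R K f)) :
    GrPiece.mk R ν φ ⟨f, hf⟩ = 0 := by
  have : GrPiece.mk R ν φ ⟨f, hf⟩ = GrPiece.mk R ν φ 0 := by
    rw [GrPiece.mk_eq_mk]
    change (φ : WithTop Γ) < ν (algebraMap R K (f - 0))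
    rwa [sub_zero]
  exact this

theorem toGr_mul_of (c : R) {φ : Γ} (a : GrPiece R ν φ) :
    toGr R ν c * DirectSum.of (GrPiece R ν) φ a = DirectSum.of (GrPiece R ν) φ (c • a) := by
  obtain ⟨f, rfl⟩ := GrPiece.mk_surjective _ a
  change DirectSum.of (GrPiece R ν) 0 (GrPiece.mk R ν 0 ⟨c, mem_valIdeal_zero c⟩) * _ = _
  rw [DirectSum.of_mul_of]
  exact DirectSum.of_eq_of_gradedMonoid_eq (GrPiece.sigma_ext (zero_add φ) rfl)

theorem toGr_mul_apply (c : R) (z : Gr R ν) (φ : Γ) : (toGr R ν c * z) φ = c • z φ := by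
  classical
  induction z using DirectSum.induction_on with
  | zero => rw [mul_zero, DirectSum.zero_apply, smul_zero]
  | of ψ a =>
    rw [toGr_mul_of]
    by_cases h : ψ = φ
    · subst h
      rw [DirectSum.of_eq_same, DirectSum.of_eq_same]
    · rw [DirectSum.of_eq_of_ne _ _ _ (Ne.symm h), DirectSum.of_eq_of_ne _ _ _ (Ne.symm h),
        smul_zero]
  | add a b ha hb => rw [mul_add, DirectSum.add_apply, DirectSum.add_apply, ha, hb, smul_add]

theorem algebraMap_residue (c : R) :
    algebraMap (IsLocalRing.ResidueField R) (Gr R ν) (IsLocalRing.residue R c) = toGr R ν c :=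
  rfl

/-- The homogeneous components of an element of the algebra generated by initial forms of elements
of `X` are represented by combinations of products of elements of `X` of the right value. -/
theorem exists_apply_eq_mk {X : Set R} (hX : ∀ f ∈ X, ν (algebraMap R K f) ≠ ⊤) {z : Gr R ν}
    (hz : z ∈ Algebra.adjoin (IsLocalRing.ResidueField R) (initialForm R ν '' X)) (φ : Γ) :
    ∃ g ∈ Submodule.span R {m | m ∈ Submonoid.closure X ∧ ν (algebraMap R K m) = φ},
      ∃ hg : g ∈ valIdeal R ν φ, z φ = GrPiece.mk R ν φ ⟨g, hg⟩ := by
  classical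
  rw [← Subalgebra.mem_toSubmodule, Algebra.adjoin_eq_span] at hz
  induction hz using Submodule.span_induction with
  | mem u hu =>
    have h1 : ∃ m ∈ Submonoid.closure X, ν (algebraMap R K m) ≠ ⊤ ∧ u = initialForm R ν m := by
      induction hu using Submonoid.closure_induction with
      | mem u hu =>
        obtain ⟨m, hm, rfl⟩ := hu
        exact ⟨m, Submonoid.subset_closure hm, hX m hm, rfl⟩
      | one => exact ⟨1, one_mem _, by simp, initialForm_one.symm⟩
      | mul a b _ _ ha hb =>
        obtain ⟨m, hm, hmν, rfl⟩ := ha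
        obtain ⟨m', hm', hmν', rfl⟩ := hb
        obtain ⟨ψ, hψ⟩ := WithTop.ne_top_iff_exists.1 hmν
        obtain ⟨ψ', hψ'⟩ := WithTop.ne_top_iff_exists.1 hmν'
        refine ⟨m * m', mul_mem hm hm', ?_, (initialForm_mul hψ.symm hψ'.symm).symm⟩
        rw [map_mul, AddValuation.map_mul]
        exact WithTop.add_ne_top.2 ⟨hmν, hmν'⟩
    obtain ⟨m, hm, hmν, rfl⟩ := h1
    obtain ⟨ψ, hψ⟩ := WithTop.ne_top_iff_exists.1 hmν
    rw [initialForm_eq_of hψ.symm]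
    by_cases h : ψ = φ
    · subst h
      exact ⟨m, Submodule.subset_span ⟨hm, hψ.symm⟩, hψ.le, DirectSum.of_eq_same _ _⟩
    · exact ⟨0, zero_mem _, zero_mem _, DirectSum.of_eq_of_ne _ _ _ (Ne.symm h)⟩
  | zero => exact ⟨0, zero_mem _, zero_mem _, rfl⟩
  | add a b _ _ ha hb =>
    obtain ⟨g, hg, hgφ, ha⟩ := ha
    obtain ⟨g', hg', hgφ', hb⟩ := hb
    refine ⟨g + g', add_mem hg hg', add_mem hgφ hgφ', ?_⟩
    rw [DirectSum.add_apply, ha, hb]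
    rfl
  | smul c a _ ha =>
    obtain ⟨g, hg, hgφ, ha⟩ := ha
    obtain ⟨c, rfl⟩ := IsLocalRing.residue_surjective c
    refine ⟨c • g, Submodule.smul_mem _ _ hg, Submodule.smul_mem _ _ hgφ, ?_⟩
    rw [Algebra.smul_def, algebraMap_residue, toGr_mul_apply, ha]
    rfl

theorem exists_lt_value_sub_of_mem_adjoin {X : Set R} (hX : ∀ f ∈ X, ν (algebraMap R K f) ≠ ⊤)
    {f : R} {φ : Γ} (hf : ν (algebraMap R K f) = φ)
    (h : initialForm R ν f ∈
      Algebra.adjoin (IsLocalRing.ResidueField R) (initialForm R ν '' X)) :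
    ∃ g ∈ Submodule.span R {m | m ∈ Submonoid.closure X ∧ ν (algebraMap R K m) = φ},
      (φ : WithTop Γ) < ν (algebraMap R K (f - g)) := by
  classical
  obtain ⟨g, hg, hgφ, h1⟩ := exists_apply_eq_mk hX h φ
  refine ⟨g, hg, ?_⟩
  rw [initialForm_eq_of hf, DirectSum.of_eq_same, GrPiece.mk_eq_mk] at h1
  exact h1

end InitialForms

section GradedRing

theorem minimal_adjoin_eq_top {F A : Type*} [CommSemiring F] [Semiring A] [Algebra F A] {S : Set A}
    (hS : Algebra.adjoin F S = ⊤) (h : ∀ a ∈ S, a ∉ Algebra.adjoin F (S \ {a})) :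
    Minimal (fun T : Set A => Algebra.adjoin F T = ⊤) S := by
  refine ⟨hS, fun T hT hTS a ha => ?_⟩
  by_contra haT
  refine h a ha (Algebra.adjoin_mono (Set.subset_sdiff_singleton hTS haT) ?_)
  have hT' : Algebra.adjoin F T = ⊤ := hT
  rw [hT']
  exact Algebra.mem_top

variable {R K Γ : Type*} [CommRing R] [IsLocalRing R] [Field K] [Algebra R K]
  [AddCommGroup Γ] [LinearOrder Γ] [IsOrderedAddMonoid Γ]
  {ν : AddValuation K (WithTop Γ)} {P : ℕ → R} {w : ℕ → ℕ → ℕ} {γ : ℕ → Γ} {Ω : ℕ∞}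
  [Dominates R ν]

variable (ν P w Ω) in
/-- The initial forms of `P_0` and of the `P_i` with `n_i > 1`, `1 ≤ i ≤ Ω`. -/
def formGenerators : Set (Gr R ν) :=
  {initialForm R ν (P 0)} ∪
    {a | ∃ i : ℕ, 1 ≤ i ∧ (i : ℕ∞) ≤ Ω ∧ 1 < nn ν P w i ∧ a = initialForm R ν (P i)}

theorem IsGenSeq.initialForm_prod {r : ℕ} (h : IsGenSeq ν P w γ r) (σ : ℕ → ℕ) {n : ℕ}
    (hn : n ≤ r + 1) : initialForm R ν (∏ s ∈ Finset.range n, P s ^ σ s) =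
      ∏ s ∈ Finset.range n, initialForm R ν (P s) ^ σ s := by
  induction n with
  | zero => exact initialForm_one
  | succ n ih =>
    have h1 := value_lmon (P := P) (γ := γ) (n := n) (fun s hs => h.value_eq s (by omega))
      fun s => (σ s : ℤ)
    rw [lmon_natCast] at h1
    have h2 : ν (algebraMap R K (P n ^ σ n)) = ((σ n • γ n : Γ) : WithTop Γ) := by
      rw [map_pow, AddValuation.map_pow, h.value_eq n (by omega), WithTop.coe_nsmul]
    rw [Finset.prod_range_succ, Finset.prod_range_succ, initialForm_mul h1 h2, ih (by omega),
      initialForm_pow (h.value_eq n (by omega))]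

theorem adjoin_formGenerators
    (hgen : ∀ i : ℕ, 1 ≤ i → (i : ℕ∞) ≤ Ω → IsGenSeq ν P w γ i)
    (happ : HasApproximation ν P w Ω) :
    Algebra.adjoin (IsLocalRing.ResidueField R) (formGenerators ν P w Ω) = ⊤ := by
  rw [eq_top_iff]
  rintro z -
  set F := Algebra.adjoin (IsLocalRing.ResidueField R) (formGenerators ν P w Ω) with hF
  induction z using DirectSum.induction_on with
  | zero => exact zero_mem _
  | add a b ha hb => exact add_mem ha hb
  | of φ a =>
    obtain ⟨⟨f, hf⟩, rfl⟩ := GrPiece.mk_surjective _ a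
    have hf' : (φ : WithTop Γ) ≤ ν (algebraMap R K f) := hf
    rcases hf'.lt_or_eq with hlt | heq
    · rw [of_mk_eq_zero hf hlt, map_zero]
      exact zero_mem _
    obtain ⟨r, hr, hrΩ, g, hg, hfg⟩ := happ f φ heq.symm
    have h := hgen r hr hrΩ
    have key : ∃ hgφ : g ∈ valIdeal R ν φ,
        DirectSum.of (GrPiece R ν) φ (GrPiece.mk R ν φ ⟨g, hgφ⟩) ∈ F := by
      clear hfg
      induction hg using Submodule.span_induction with
      | mem m hm =>
        obtain ⟨σ, hσ, rfl, hm⟩ := hm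
        refine ⟨hm.ge, ?_⟩
        rw [← initialForm_eq_of hm, h.initialForm_prod σ le_rfl]
        refine prod_mem fun s hs => ?_
        have hs' := Nat.lt_succ_iff.1 (Finset.mem_range.1 hs)
        rcases Nat.eq_zero_or_pos s with rfl | hpos
        · exact F.pow_mem (Algebra.subset_adjoin (Or.inl rfl)) _
        · by_cases hn : 1 < nn ν P w s
          · exact F.pow_mem (Algebra.subset_adjoin
              (Or.inr ⟨s, hpos, le_trans (by exact_mod_cast hs') hrΩ, hn, rfl⟩)) _
          · have h1 : (σ s : ℕ∞) < 1 := lt_of_lt_of_le (hσ s hpos hs') (not_lt.1 hn)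
            have h2 : σ s = 0 := by
              have : σ s < 1 := by exact_mod_cast h1
              omega
            rw [h2, pow_zero]
            exact one_mem _
      | zero => exact ⟨zero_mem _, by
          rw [show GrPiece.mk R ν φ ⟨0, zero_mem _⟩ = 0 from rfl, map_zero]; exact zero_mem _⟩
      | add a b _ _ ha hb =>
        obtain ⟨ha, ha'⟩ := ha
        obtain ⟨hb, hb'⟩ := hb
        refine ⟨add_mem ha hb, ?_⟩
        have := add_mem ha' hb'
        rwa [← map_add] at this
      | smul c a _ ha =>
        obtain ⟨ha, ha'⟩ := ha
        refine ⟨Submodule.smul_mem _ _ ha, ?_⟩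
        have := mul_mem (F.algebraMap_mem (IsLocalRing.residue R c)) ha'
        rwa [algebraMap_residue, toGr_mul_of] at this
    obtain ⟨hgφ, hgF⟩ := key
    rwa [GrPiece.mk_eq_mk.2 (show ((⟨f, hf⟩ : valIdeal R ν φ) : R) -
      (⟨g, hgφ⟩ : valIdeal R ν φ) ∈ valIdealGT R ν φ from hfg)]

/-- Products of members of the sequence other than `P_{i+1}` whose value is at most that of
`P_{i+1}` are monomials in `P_0, …, P_i`. -/
theorem exists_eq_prod_of_mem_closure
    (hgen : ∀ i : ℕ, 1 ≤ i → (i : ℕ∞) ≤ Ω → IsGenSeq ν P w γ i) {i : ℕ} {m : R}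
    (hm : m ∈ Submonoid.closure {f | ∃ j : ℕ, (j : ℕ∞) ≤ Ω ∧ j ≠ i + 1 ∧ f = P j})
    (hle : ν (algebraMap R K m) ≤ γ (i + 1)) :
    ∃ σ : ℕ → ℕ, m = ∏ s ∈ Finset.range (i + 1), P s ^ σ s := by
  classical
  induction hm using Submonoid.closure_induction with
  | mem f hf =>
    obtain ⟨j, hjΩ, hj, rfl⟩ := hf
    have hji : j < i + 1 := by
      by_contra hlt
      have h1 := hgen j (by omega) hjΩ
      rw [h1.value_eq j le_rfl, WithTop.coe_le_coe] at hle
      exact absurd hle (not_le.2 (h1.strictMono (by omega) (by omega) le_rfl))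
    refine ⟨Pi.single j 1, ?_⟩
    rw [Finset.prod_eq_single_of_mem j (Finset.mem_range.2 hji), Pi.single_eq_same, pow_one]
    intro s _ hs
    rw [Pi.single_eq_of_ne hs, pow_zero]
  | one => exact ⟨0, by simp⟩
  | mul a b _ _ ha hb =>
    rw [map_mul, AddValuation.map_mul] at hle
    obtain ⟨σ, rfl⟩ := ha (le_trans (le_add_of_nonneg_right (Dominates.nonneg (ν := ν) b)) hle)
    obtain ⟨τ, rfl⟩ := hb (le_trans (le_add_of_nonneg_left (Dominates.nonneg (ν := ν) _)) hle)
    exact ⟨σ + τ, by simp [pow_add, Finset.prod_mul_distrib]⟩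

/-- If the initial form of `P_{i+1}` is in the algebra generated by those of other members of the
sequence, then `n_{i+1} = 1`. -/
theorem nn_eq_one_of_mem_adjoin
    (hgen : ∀ i : ℕ, 1 ≤ i → (i : ℕ∞) ≤ Ω → IsGenSeq ν P w γ i) {i : ℕ}
    (hi : ((i + 1 : ℕ) : ℕ∞) ≤ Ω)
    (hmem : initialForm R ν (P (i + 1)) ∈ Algebra.adjoin (IsLocalRing.ResidueField R)
      (initialForm R ν '' {f | ∃ j : ℕ, (j : ℕ∞) ≤ Ω ∧ j ≠ i + 1 ∧ f = P j})) :
    nn ν P w (i + 1) = 1 := by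
  have h := hgen (i + 1) (by omega) hi
  have hPi := h.value_eq (i + 1) le_rfl
  obtain ⟨g, hg, hlt⟩ := exists_lt_value_sub_of_mem_adjoin (φ := γ (i + 1)) (by
    rintro f ⟨j, hjΩ, -, rfl⟩
    rcases Nat.eq_zero_or_pos j with rfl | hj
    · rw [h.value_eq 0 (by omega)]
      exact WithTop.coe_ne_top
    · rw [(hgen j hj hjΩ).value_eq j le_rfl]
      exact WithTop.coe_ne_top) hPi hmem
  have hg' : g ∈ monomialSpan ν P i (γ (i + 1)) := by
    refine Submodule.span_mono ?_ hg
    rintro m ⟨hm, hmν⟩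
    obtain ⟨σ, rfl⟩ := exists_eq_prod_of_mem_closure hgen hm hmν.le
    exact ⟨σ, rfl, hmν⟩
  obtain ⟨m, σ, rfl, hm⟩ := nonempty_of_lt_value_sub hPi hg' hlt
  rw [(h.mono i.le_succ).value_prod, WithTop.coe_inj] at hm
  have hn1 : nbar ν P (i + 1) = 1 := by
    refine nbar_succ_eq_one hPi ?_
    rw [← hm]
    exact lval_mem_valGroup (fun j hj => h.value_eq j (by omega)) _
  have hU := h.lval_uexp
  rw [hn1, ENat.toNat_one, Nat.cast_one, one_smul] at hU
  have hα := (h.mono i.le_succ).toHasValues.valResidue_div_mem hU hg' hlt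
  have hd1 : deg ν P w (i + 1) = 1 := by
    rw [deg_succ_eq_one_iff, alpha_eq, alphaLift, hn1, ENat.toNat_one, pow_one]
    exact hα
  rw [nn, hn1, hd1, one_mul]

/-- The initial form of `x` is in the algebra generated by those of the `P_j` with `j ≥ 1` only if
`y` has the same value as `x` and `in(x)` is a multiple of `in(y)`, hence `n_1 = 1`. -/
theorem initialForm_zero_notMem_adjoin (h1Ω : 1 ≤ Ω)
    (hgen : ∀ i : ℕ, 1 ≤ i → (i : ℕ∞) ≤ Ω → IsGenSeq ν P w γ i) (hmin : γ 0 ≤ γ 1) :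
    initialForm R ν (P 0) ∉ Algebra.adjoin (IsLocalRing.ResidueField R)
      (initialForm R ν '' {f | ∃ j : ℕ, 1 ≤ j ∧ (j : ℕ∞) ≤ Ω ∧ 1 < nn ν P w j ∧ f = P j}) := by
  intro hmem
  have h := hgen 1 le_rfl (by exact_mod_cast h1Ω)
  have hP0 := h.value_eq 0 (by omega)
  have hP1 := h.value_eq 1 le_rfl
  obtain ⟨g, hg, hlt⟩ := exists_lt_value_sub_of_mem_adjoin (φ := γ 0) (by
    rintro f ⟨j, hj, hjΩ, -, rfl⟩
    rw [(hgen j hj hjΩ).value_eq j le_rfl]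
    exact WithTop.coe_ne_top) hP0 hmem
  have key : ∀ m ∈ Submonoid.closure
      {f | ∃ j : ℕ, 1 ≤ j ∧ (j : ℕ∞) ≤ Ω ∧ 1 < nn ν P w j ∧ f = P j},
      ν (algebraMap R K m) ≤ γ 0 → m = 1 ∨ (m = P 1 ∧ 1 < nn ν P w 1) := by
    intro m hm
    induction hm using Submonoid.closure_induction with
    | mem f hf =>
      obtain ⟨j, hj, hjΩ, hn, rfl⟩ := hf
      intro hle
      rcases hj.lt_or_eq with hlt | rfl
      · have h1 := hgen j hj hjΩ
        rw [h1.value_eq j le_rfl, WithTop.coe_le_coe] at hle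
        exact absurd (hmin.trans_lt (h1.strictMono le_rfl hlt le_rfl)) (not_lt.2 hle)
      · exact Or.inr ⟨rfl, hn⟩
    | one => exact fun _ => Or.inl rfl
    | mul a b _ _ ha hb =>
      intro hle
      rw [map_mul, AddValuation.map_mul] at hle
      have ha' := ha (le_trans (le_add_of_nonneg_right (Dominates.nonneg (ν := ν) b)) hle)
      have hb' := hb (le_trans (le_add_of_nonneg_left (Dominates.nonneg (ν := ν) a)) hle)
      rcases ha' with rfl | ⟨rfl, hn⟩
      · rwa [one_mul]
      · rcases hb' with rfl | ⟨rfl, -⟩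
        · rw [mul_one]
          exact Or.inr ⟨rfl, hn⟩
        · rw [hP1, ← WithTop.coe_add, WithTop.coe_le_coe] at hle
          exact absurd (hmin.trans_lt (lt_add_of_pos_right _ (h.pos 1 le_rfl))) (not_lt.2 hle)
  have hmon : ∀ m, m ∈ Submonoid.closure
      {f | ∃ j : ℕ, 1 ≤ j ∧ (j : ℕ∞) ≤ Ω ∧ 1 < nn ν P w j ∧ f = P j} ∧
      ν (algebraMap R K m) = γ 0 → m = P 1 ∧ 1 < nn ν P w 1 := by
    rintro m ⟨hm, hmν⟩
    refine (key m hm hmν.le).resolve_left ?_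
    rintro rfl
    rw [map_one, AddValuation.map_one] at hmν
    exact (h.pos 0 (by omega)).ne (WithTop.coe_injective hmν)
  obtain ⟨m, hm⟩ := nonempty_of_lt_value_sub hP0 hg hlt
  obtain ⟨rfl, hn⟩ := hmon m hm
  have h01 : γ 1 = γ 0 := WithTop.coe_injective (hP1.symm.trans hm.2)
  have hg1 : g ∈ Submodule.span R {P 1} := Submodule.span_mono (fun m hm => (hmon m hm).1) hg
  obtain ⟨c, rfl⟩ := Submodule.mem_span_singleton.1 hg1
  have hn1 : nbar ν P 1 = 1 := by
    refine nbar_succ_eq_one (γ := γ) (i := 0) hP1 ?_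
    rw [zero_add, h01]
    exact mem_valGroup le_rfl hP0
  have hU := h.lval_uexp
  simp only [zero_add] at hU
  rw [hn1, ENat.toNat_one, Nat.cast_one, one_smul, h01] at hU
  have h0 : HasValues ν P w γ 0 := h.toHasValues.mono (by omega)
  -- the residues of `x / U_1` and `y / U_1` are proportional by an element of `k`
  set M := lmon K P (uexp ν P w 1) 1 with hM
  have hM0 : M ≠ 0 := lmon_ne_zero (fun s hs => h.ne_zero (by omega)) _
  have hMν : ν M = γ 0 := by rw [hM, value_lmon fun s hs => h.value_eq s (by omega), hU]
  have hxM : ν (algebraMap R K (P 0) / M) = 0 := value_div_eq_zero hM0 (by rw [hMν, hP0])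
  have hyM : ν (algebraMap R K (P 1) / M) = 0 := value_div_eq_zero hM0 (by rw [hMν, hP1, h01])
  have hα : alpha ν P w 1 = valResidue ν (algebraMap R K (P 1) / M) := by
    rw [alpha_eq, alphaLift, hn1, ENat.toNat_one, pow_one]
  have hdiff : 0 < ν (algebraMap R K (P 0 - c • P 1) / M) := value_div_pos hM0 (by rwa [hMν])
  have hc : 0 ≤ ν (algebraMap R K c) := Dominates.nonneg (ν := ν) c
  have hcM : 0 ≤ ν (algebraMap R K c * (algebraMap R K (P 1) / M)) := by
    rw [AddValuation.map_mul, hyM, add_zero]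
    exact hc
  have hprop : valResidue ν (algebraMap R K (P 0) / M) =
      algebraMap (IsLocalRing.ResidueField R) _ (IsLocalRing.residue R c) * alpha ν P w 1 := by
    have e : algebraMap R K (P 0) / M = algebraMap R K (P 0 - c • P 1) / M +
        algebraMap R K c * (algebraMap R K (P 1) / M) := by
      rw [smul_eq_mul, map_sub, map_mul]
      ring
    rw [e, valResidue_add hdiff.le hcM, valResidue_eq_zero hdiff, zero_add,
      valResidue_mul hc hyM.ge, valResidue_algebraMap, hα]
  have hne := valResidue_ne_zero hxM
  have hx0 : valResidue ν (algebraMap R K (P 0) / M) ∈ alphaField ν P w 0 := by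
    refine h0.valResidue_div_mem (φ := γ 0) (g := P 0) hU ?_ ?_
    · exact Submodule.subset_span ⟨fun _ => 1, by simp, hP0⟩
    · rw [sub_self, map_zero, AddValuation.map_zero]
      exact WithTop.coe_lt_top _
  have hd1 : deg ν P w 1 = 1 := by
    refine deg_succ_eq_one_iff.2 ?_
    rw [hprop] at hne hx0
    have hc0 := left_ne_zero_of_mul hne
    have := mul_mem (inv_mem (IntermediateField.algebraMap_mem (alphaField ν P w 0)
      (IsLocalRing.residue R c))) hx0
    rwa [inv_mul_cancel_left₀ hc0] at this
  rw [nn, hn1, hd1, one_mul] at hn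
  exact hn.false

theorem minimal_formGenerators (h1Ω : 1 ≤ Ω)
    (hgen : ∀ i : ℕ, 1 ≤ i → (i : ℕ∞) ≤ Ω → IsGenSeq ν P w γ i)
    (happ : HasApproximation ν P w Ω) (hmin : γ 0 ≤ γ 1) :
    Minimal (fun T : Set (Gr R ν) => Algebra.adjoin (IsLocalRing.ResidueField R) T = ⊤)
      (formGenerators ν P w Ω) := by
  refine minimal_adjoin_eq_top (adjoin_formGenerators hgen happ) ?_
  rintro a (rfl | ⟨i, hi, hiΩ, hn, rfl⟩) hmem
  · refine initialForm_zero_notMem_adjoin h1Ω hgen hmin (Algebra.adjoin_mono ?_ hmem)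
    rintro b ⟨rfl | ⟨j, hj, hjΩ, hn, rfl⟩, hne⟩
    exacts [absurd rfl hne, ⟨P j, ⟨j, hj, hjΩ, hn, rfl⟩, rfl⟩]
  · obtain ⟨i, rfl⟩ : ∃ l, i = l + 1 := ⟨i - 1, by omega⟩
    have h1 := nn_eq_one_of_mem_adjoin hgen hiΩ (Algebra.adjoin_mono ?_ hmem)
    · rw [h1] at hn
      exact hn.false
    rintro b ⟨rfl | ⟨j, hj, hjΩ, -, rfl⟩, hne⟩
    · exact ⟨P 0, ⟨0, by simp, by omega, rfl⟩, rfl⟩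
    · refine ⟨P j, ⟨j, hjΩ, ?_, rfl⟩, rfl⟩
      rintro rfl
      exact hne rfl

end GradedRing

end ValSemigroup

end

open ValSemigroup in
theorem theorem4p9 {R K Γ : Type*} [CommRing R] [IsRegularLocalRing R]
    (hdim : ringKrullDim R = 2)
    [Field K] [Algebra R K] [IsFractionRing R K]
    [AddCommGroup Γ] [LinearOrder Γ] [IsOrderedAddMonoid Γ]
    (ν : AddValuation K (WithTop Γ)) [Dominates R ν]
    (hrank : Nonempty (AddValuation.toValuation ν).RankOne)
    (x y : R) (hxy : IsLocalRing.maximalIdeal R = Ideal.span {x, y})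
    (hx : IsLeast ((fun f : R => ν (algebraMap R K f)) '' (IsLocalRing.maximalIdeal R : Set R))
      (ν (algebraMap R K x)))
    (CS : Set R) (hCS : IsCoefficientSet CS)
    (Ω : ℕ∞) (P : ℕ → R) (w : ℕ → ℕ → ℕ) (hP : IsAlgorithmOutput ν CS x y Ω P w) :
    Minimal (fun T : Set (Gr R ν) => Algebra.adjoin (IsLocalRing.ResidueField R) T = ⊤)
      ({initialForm R ν x} ∪
        {a | ∃ i : ℕ, 1 ≤ i ∧ (i : ℕ∞) ≤ Ω ∧ 1 < nn ν P w i ∧ a = initialForm R ν (P i)}) ∧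
    Minimal (fun T : Set Γ => AddSubmonoid.closure T = valueSemigroup R ν)
      ({γ | ν (algebraMap R K x) = (γ : WithTop Γ)} ∪
        {γ | ∃ i : ℕ, 1 ≤ i ∧ (i : ℕ∞) ≤ Ω ∧ 1 < nbar ν P i ∧
          ν (algebraMap R K (P i)) = (γ : WithTop Γ)}) ∧
    IntermediateField.adjoin (IsLocalRing.ResidueField R)
      {a : ValResidueField ν | ∃ i : ℕ, 1 ≤ i ∧ (i : ℕ∞) ≤ Ω ∧ 1 < deg ν P w i ∧
        a = alpha ν P w i} = ⊤ := by
  have : IsDomain R := (IsFractionRing.injective R K).isDomain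
  have hgen := hP.isGenSeq hdim hxy
  have happ := hP.hasApproximation hrank hxy hx hCS hgen
  have h1 := hgen 1 le_rfl hP.one_le
  obtain ⟨rfl, rfl⟩ : P 0 = x ∧ P 1 = y := ⟨hP.P_zero, hP.P_one⟩
  have hmin : genVal ν P 0 ≤ genVal ν P 1 := by
    have h2 := hx.2 ⟨P 1, hxy ▸ Ideal.subset_span (by simp), rfl⟩
    change ν (algebraMap R K (P 0)) ≤ ν (algebraMap R K (P 1)) at h2
    rwa [h1.value_eq 0 (by omega), h1.value_eq 1 le_rfl, WithTop.coe_le_coe] at h2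
  exact ⟨minimal_formGenerators hP.one_le hgen happ hmin,
    minimal_values hP.one_le hgen happ hmin, adjoin_alpha_eq_top hgen happ⟩
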